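/- **Setting.** Let $Q(v)=v_0^2-v_1^2-v_2^2-v_3^2$ on $\mathbb R^4$, $\mathbb H^3=\{Q=1,\ v_0>0\}$, and identify $I(\mathbb H^3)$ with the group of linear automorphisms of $\mathbb R^4$ preserving $Q$ and $\mathbb H^3$; $T$ is orientation-preserving (reversing) if $\det T>0$ ($<0$). The light-like rays form the conformal boundary, identified with $\hat{\mathbb C}=\mathbb C\cup\{\infty\}$ by stereographic projection. We say that $f\in I(\mathbb H^3)$ is *induced by* $A=\begin{pmatrix}a&b\\c&d\end{pmatrix}\in GL(2,\mathbb C)$ if $f$ acts on $\hat{\mathbb C}$ as $z\mapsto\frac{az+b}{cz+d}$ when $f$ preserves orientation, and as $z\mapsto\frac{a\bar z+b}{c\bar z+d}$ when $f$ reverses orientation. **Types.** Write the characteristic polynomial of $T\in I(\mathbb H^3)$ as $$\chi_T(x)=(x-1)^l(x+1)^m\,h(x)\prod_{j}(x^2-2a_jx+1),\qquad |a_j|<1,$$ the $a_j$ listed with multiplicity, and let $k=\#\{j\}+\lfloor m/2\rfloor$. $T$ is *elliptic* if $h=1$ and $T$ has an eigenvector $v$ with $Q(v)>0$; *hyperbolic*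 if $h=(x-r)(x-r^{-1})$ with $r$ real, $r\ne\pm1$; *parabolic* if $h=1$ and $T$ is not semisimple. It is then called *$k$-rotatory elliptic (hyperbolic, parabolic)* if $m$ is even, and a *$k$-rotatory elliptic (hyperbolic, parabolic) inversion* if $m$ is odd. $T$ has *rotation angle* $\theta\in(0,\pi]$ if $x^2-2x\cos\theta+1$ divides $\chi_T$. A *stretch* is a $0$-rotatory hyperbolic, a *stretch half-turn* a $1$-rotatory hyperbolic with rotation angle $\pi$, a *half-turn* a $1$-rotatory elliptic with rotation angle $\pi$, a *translation* a $0$-rotatory parabolic. A *circle inversion* is an isometry acting on $\hat{\mathbb C}$ as the inversion in a Euclidean circle or the reflection in a line. An *antipodal map* is an orientation-reversing isometry of order $2$ without fixed points on $\hat{\mathbb C}$. **Theorem.** Let $f$ be an isometry of $\mathbb H^3$ induced by $A\in GL(2,\mathbb C)$, and for $M\in GL(2,\mathbb C)$ put $c(M)=\dfrac{(\operatorname{tr}M)^2}{\det M}$. I. Suppose $f$ is orientation-preserving. (i) If $c(A)\notin\mathbb R$, then $f$ is $1$-rotatory hyperbolic and is not a stretch half-turn. (ii) If $c(A)\in\mathbb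 R$ and $|c(A)-2|>2$, then $f$ is a stretch if $c(A)>0$ and a stretch half-turn if $c(A)<0$. (iii) If $c(A)\in\mathbb R\setminus\{0\}$ and $|c(A)-2|<2$, then $f$ is $1$-rotatory elliptic and is not a half-turn. (iv) If $c(A)=0$, then $f$ is a half-turn. (v) If $c(A)\in\mathbb R\setminus\{0\}$, $|c(A)-2|=2$ and $A$ is not scalar, then $f$ is a translation. (vi) If $c(A)\in\mathbb R\setminus\{0\}$, $|c(A)-2|=2$ and $A$ is scalar, then $f$ is the identity. II. Suppose $f$ is orientation-reversing, and let $B=A\bar A$. Then $c(B)$ is a non-negative real number. (i) If $c(B)=0$ or $|c(B)-2|<2$, then $f$ is a $1$-rotatory elliptic inversion. (ii) If $|c(B)-2|>2$, then $f$ is a $0$-rotatory hyperbolic inversion. (iii) If $c(B)\ne0$, $|c(B)-2|=2$ and $B$ is not scalar, then $f$ is a $0$-rotatory parabolic inversion. (iv) If $c(B)\ne0$, $|c(B)-2|=2$ and $B$ is scalar, then $f$ is a circle inversion or an antipodal map, and in both cases it is a $k$-rotatory elliptic inversion for some $k$. Moreover there is a non-zero $u\in\mathbb C$, unique up to a non-zero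 real multiple, such that $uA=\begin{pmatrix}a&b\\c&-\bar a\end{pmatrix}$ with $b,c$ real; then $\det(uA)$ is a non-zero real number, and $f$ is a circle inversion if and only if $\det(uA)<0$, and an antipodal map if and only if $\det(uA)>0$. Every circle inversion is a $0$-rotatory elliptic inversion, and every antipodal map is a $1$-rotatory elliptic inversion. -/

import Mathlib

open Polynomial

noncomputable section

namespace HypThree

/-- The four-dimensional real vector space of the linear model; coordinate `0` is the time
coordinate. -/
abbrev V : Type := Fin 4 → ℝ

/-- The quadratic form of signature `(1, 3)`. -/
def Q (v : V) : ℝ := v 0 ^ 2 - v 1 ^ 2 - v 2 ^ 2 - v 3 ^ 2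

/-- Hyperbolic 3-space: the upper sheet of the hyperboloid `Q = 1`. -/
def sheet : Set V := {v | Q v = 1 ∧ 0 < v 0}

/-- The full isometry group of hyperbolic 3-space, in the linear model: the linear automorphisms
preserving the form `Q` and the upper sheet of the hyperboloid. -/
def Isom : Subgroup (V ≃ₗ[ℝ] V) where
  carrier := {T | (∀ v, Q (T v) = Q v) ∧ ∀ v, T v ∈ sheet ↔ v ∈ sheet}
  mul_mem' := by
    rintro S T ⟨hS, hS'⟩ ⟨hT, hT'⟩
    exact ⟨fun v => by rw [LinearEquiv.mul_apply, hS, hT],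
      fun v => by rw [LinearEquiv.mul_apply, hS', hT']⟩
  one_mem' := ⟨fun _ => rfl, fun _ => Iff.rfl⟩
  inv_mem' := by
    rintro T ⟨hT, hT'⟩
    have key : ∀ v, T (T⁻¹ v) = v := fun v => T.apply_symm_apply v
    exact ⟨fun v => by rw [← hT, key], fun v => by rw [← hT', key]⟩

/-- The underlying linear operator of an isometry. -/
def lin (f : Isom) : V →ₗ[ℝ] V := ((f : V ≃ₗ[ℝ] V) : V →ₗ[ℝ] V)

/-- Since `f` preserves the time direction, it preserves the orientation of the sheet iff it
preserves that of the ambient vector space. -/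
def OrientationPreserving (f : Isom) : Prop := 0 < LinearMap.det (lin f)

def OrientationReversing (f : Isom) : Prop := LinearMap.det (lin f) < 0

/-! ### Dynamical types -/

/-- The polynomial `(x - 1)^l (x + 1)^m ∏ (x² - 2 a x + 1)`, the product being over the
elements `a` of the multiset `s` (so a factor of multiplicity `r` occurs `r` times). -/
def rotPoly (l m : ℕ) (s : Multiset ℝ) : ℝ[X] :=
  (X - 1) ^ l * (X + 1) ^ m * (s.map fun a => X ^ 2 - C (2 * a) * X + 1).prod

/-- `f` has a time-like eigenvector, and the numbers `m` (multiplicity of `-1`) and `k` are read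
off its characteristic polynomial. -/
def EllipticData (m k : ℕ) (f : Isom) : Prop :=
  (∃ v : V, 0 < Q v ∧ ∃ t : ℝ, lin f v = t • v) ∧
  ∃ (l : ℕ) (s : Multiset ℝ), (∀ a ∈ s, |a| < 1) ∧
    (lin f).charpoly = rotPoly l m s ∧ k = s.card + m / 2

/-- `f` has a pair of real eigenvalues `r, r⁻¹` with `r ≠ ±1`, and `m`, `k` are as above. -/
def HyperbolicData (m k : ℕ) (f : Isom) : Prop :=
  ∃ (r : ℝ) (l : ℕ) (s : Multiset ℝ), r ≠ 1 ∧ r ≠ -1 ∧ (∀ a ∈ s, |a| < 1) ∧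
    (lin f).charpoly = rotPoly l m s * (X - C r) * (X - C r⁻¹) ∧ k = s.card + m / 2

/-- `f` is not semisimple, and `m`, `k` are as above. -/
def ParabolicData (m k : ℕ) (f : Isom) : Prop :=
  ¬ Module.End.IsSemisimple (lin f) ∧
  ∃ (l : ℕ) (s : Multiset ℝ), (∀ a ∈ s, |a| < 1) ∧
    (lin f).charpoly = rotPoly l m s ∧ k = s.card + m / 2

/-- `k`-rotatory elliptic. -/
def RotatoryElliptic (k : ℕ) (f : Isom) : Prop := ∃ m, Even m ∧ EllipticData m k f

/-- `k`-rotatory elliptic inversion. -/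
def RotatoryEllipticInversion (k : ℕ) (f : Isom) : Prop := ∃ m, Odd m ∧ EllipticData m k f

/-- `k`-rotatory hyperbolic. -/
def RotatoryHyperbolic (k : ℕ) (f : Isom) : Prop := ∃ m, Even m ∧ HyperbolicData m k f

/-- `k`-rotatory hyperbolic inversion. -/
def RotatoryHyperbolicInversion (k : ℕ) (f : Isom) : Prop := ∃ m, Odd m ∧ HyperbolicData m k f

/-- `k`-rotatory parabolic. -/
def RotatoryParabolic (k : ℕ) (f : Isom) : Prop := ∃ m, Even m ∧ ParabolicData m k f

/-- `k`-rotatory parabolic inversion. -/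
def RotatoryParabolicInversion (k : ℕ) (f : Isom) : Prop := ∃ m, Odd m ∧ ParabolicData m k f

/-- `θ ∈ (0, π]` is a rotation angle of `f` when `(x - e^{iθ})(x - e^{-iθ})` divides the
characteristic polynomial. -/
def HasRotationAngle (θ : ℝ) (f : Isom) : Prop :=
  0 < θ ∧ θ ≤ Real.pi ∧ X ^ 2 - C (2 * Real.cos θ) * X + 1 ∣ (lin f).charpoly

def IsStretch (f : Isom) : Prop := RotatoryHyperbolic 0 f

def IsStretchHalfTurn (f : Isom) : Prop := RotatoryHyperbolic 1 f ∧ HasRotationAngle Real.pi f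

def IsHalfTurn (f : Isom) : Prop := RotatoryElliptic 1 f ∧ HasRotationAngle Real.pi f

def IsTranslation (f : Isom) : Prop := RotatoryParabolic 0 f

/-! ### The action on the conformal boundary -/

/-- The light-like vector over a point of the boundary: for `z = x + iy` it is `|z|² + 1` times
`(1, p)`, where `p` is the point of the unit sphere corresponding to `z` under stereographic
projection, and for `z = ∞` it is `(1, p)` with `p` the north pole. -/
def light : OnePoint ℂ → V
  | none => ![1, 0, 0, 1]
  | some z => ![Complex.normSq z + 1, 2 * z.re, 2 * z.im, Complex.normSq z - 1]

/-- The map induced by `f` on the conformal boundary (the light-like rays, identified with the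
extended complex plane) is `φ`. -/
def BoundaryMap (f : Isom) (φ : OnePoint ℂ → OnePoint ℂ) : Prop :=
  ∀ p, ∃ t : ℝ, 0 < t ∧ lin f (light p) = t • light (φ p)

/-- Complex conjugation, extended by `∞ ↦ ∞`. -/
def conjHat : OnePoint ℂ → OnePoint ℂ := OnePoint.map (starRingEnd ℂ)

/-- `f` is induced by `A = (a b; c d)`: it acts on the extended complex plane as
`z ↦ (a z + b) / (c z + d)` if it preserves orientation, and as
`z ↦ (a z̄ + b) / (c z̄ + d)` if it reverses orientation. -/
def InducedBy (f : Isom) (A : GL (Fin 2) ℂ) : Prop :=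
  (OrientationPreserving f ∧ BoundaryMap f (fun z => A • z)) ∨
  (OrientationReversing f ∧ BoundaryMap f (fun z => A • conjHat z))

/-- Inversion in a circle of the extended complex plane: in a Euclidean circle with centre `w` and
radius `R`, or in a line `w + ℝ e` together with `∞`. -/
def IsInversionMap (φ : OnePoint ℂ → OnePoint ℂ) : Prop :=
  (∃ (w : ℂ) (R : ℝ), 0 < R ∧ φ OnePoint.infty = (w : OnePoint ℂ) ∧
    φ (w : OnePoint ℂ) = OnePoint.infty ∧
    ∀ z : ℂ, z ≠ w → φ (z : OnePoint ℂ) = ((EuclideanGeometry.inversion w R z : ℂ) : OnePoint ℂ)) ∨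
  (∃ w e : ℂ, ‖e‖ = 1 ∧ φ OnePoint.infty = OnePoint.infty ∧
    ∀ z : ℂ, φ (z : OnePoint ℂ) = ((w + e ^ 2 * starRingEnd ℂ (z - w) : ℂ) : OnePoint ℂ))

/-- `f` acts as an inversion in a circle of the extended complex plane. -/
def IsCircleInversion (f : Isom) : Prop := ∃ φ, BoundaryMap f φ ∧ IsInversionMap φ

/-- An antipodal map: orientation-reversing, of order two, and without a fixed point on the
extended complex plane. -/
def IsAntipodal (f : Isom) : Prop :=
  OrientationReversing f ∧ orderOf f = 2 ∧ ∃ φ, BoundaryMap f φ ∧ ∀ p, φ p ≠ p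

/-! ### The numerical invariant -/

/-- `c(M) = (tr M)² / det M`. -/
def cInv (M : Matrix (Fin 2) (Fin 2) ℂ) : ℂ := M.trace ^ 2 / M.det

def IsScalar (M : Matrix (Fin 2) (Fin 2) ℂ) : Prop := ∃ z : ℂ, M = z • (1 : Matrix (Fin 2) (Fin 2) ℂ)

/-- `B = A Ā`, where `Ā` is the entrywise conjugate. -/
def sqMatrix (A : GL (Fin 2) ℂ) : Matrix (Fin 2) (Fin 2) ℂ :=
  (A : Matrix (Fin 2) (Fin 2) ℂ) * (A : Matrix (Fin 2) (Fin 2) ℂ).map (starRingEnd ℂ)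

/-- `M` has the form `(a b; c -ā)` with `b`, `c` real. -/
def IsNormalized (M : Matrix (Fin 2) (Fin 2) ℂ) : Prop :=
  ∃ (a : ℂ) (b c : ℝ), M = !![a, (b : ℂ); (c : ℂ), -(starRingEnd ℂ a)]

end HypThree

end

/-! Identify `V` with the Hermitian `2 × 2` matrices, so that `Q` is the determinant and the
light-like ray over `p` is spanned by the rank-one matrix `x x*`, with `x` homogeneous coordinates
of `p`. Then `H ↦ A H A*` moves light-like rays as `A` moves boundary points, and enough rays
determine a linear map up to scale. So `f` is `H ↦ |det A|⁻¹ A H A*`, or the same with `Hᵀ` for `H`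
when orientation is reversed (`actsBy_of_boundaryMap`, `actsByConj_of_boundaryMap`).

Over `ℂ` this operator is a multiple of `A ⊗ Ā`, composed with the flip in the reversing case. Its
characteristic polynomial depends only on `c(A)`, respectively on `τ = tr(A Ā) / |det A|`, where
`c(A Ā) = τ²` (the two `charpoly_eq` lemmas). Factoring it gives every numerical part of the type.
What remains is not visible in the polynomial:

Elliptic maps need a time-like eigenvector. For `0 ≤ c < 4` it is a positive definite matrix
(`exists_posDef_of_cInv`); a reversing `f` inherits one from `f²` by averaging.

Parabolic maps must fail to be semisimple. Otherwise `f`, or `f²` when `f` is reversing, would be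
the identity and `A`, or `A Ā`, scalar. The value `τ = -2` does not interfere, since it already
forces `A Ā` to be scalar (`isScalar_of_sqTrace`).

If `A Ā` is scalar, then `Ā` is a unimodular multiple of `adj A`, and a suitable rescaling gives `M̄
= -adj M`, the normalized form (`exists_normalizing_scalar`). The fixed-point equation of `z ↦ M z̄`
is then a real circle or line if `det M < 0`, and has no solution if `det M > 0`. This separates
circle inversions from antipodal maps. -/

noncomputable section

namespace HypThree

open Matrix ComplexConjugate

/-! ### Hermitian matrices as a model of the quadratic space -/

/-- The identification of `V` with the Hermitian `2 × 2` matrices, under which `Q` becomes the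
determinant. -/
def herm : V →ₗ[ℝ] Matrix (Fin 2) (Fin 2) ℂ where
  toFun v := !![((v 0 + v 3 : ℝ) : ℂ), v 1 + v 2 * Complex.I;
    v 1 - v 2 * Complex.I, ((v 0 - v 3 : ℝ) : ℂ)]
  map_add' v w := by
    ext i j
    fin_cases i <;> fin_cases j <;> simp <;> ring
  map_smul' t v := by
    ext i j
    fin_cases i <;> fin_cases j <;> simp <;> ring

lemma herm_apply (v : V) : herm v = !![((v 0 + v 3 : ℝ) : ℂ), v 1 + v 2 * Complex.I;
    v 1 - v 2 * Complex.I, ((v 0 - v 3 : ℝ) : ℂ)] := rfl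

lemma det_herm (v : V) : (herm v).det = (Q v : ℂ) := by
  rw [herm_apply, det_fin_two_of, Q]
  push_cast
  linear_combination ((v 2 : ℂ) ^ 2) * Complex.I_sq

lemma herm_injective : Function.Injective herm := by
  intro v w h
  have h00 := congrArg Complex.re (congrFun (congrFun h 0) 0)
  have h01 := congrFun (congrFun h 0) 1
  have h11 := congrArg Complex.re (congrFun (congrFun h 1) 1)
  have hr := congrArg Complex.re h01
  have hi := congrArg Complex.im h01
  simp [herm_apply] at h00 hr hi h11
  ext i
  fin_cases i
  · change v 0 = w 0; linarith
  · exact hr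
  · exact hi
  · change v 3 = w 3; linarith

lemma exists_herm_eq {H : Matrix (Fin 2) (Fin 2) ℂ} (hH : Hᴴ = H) : ∃ v, herm v = H := by
  have h00 := congrArg Complex.im (congrFun (congrFun hH 0) 0)
  have h01 := congrFun (congrFun hH 1) 0
  have h11 := congrArg Complex.im (congrFun (congrFun hH 1) 1)
  have hr := congrArg Complex.re h01
  have hi := congrArg Complex.im h01
  simp [conjTranspose_apply] at h00 hr hi h11
  refine ⟨![((H 0 0).re + (H 1 1).re) / 2, (H 0 1).re, (H 0 1).im,
    ((H 0 0).re - (H 1 1).re) / 2], ?_⟩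
  ext i j
  fin_cases i <;> fin_cases j <;> apply Complex.ext <;> simp [herm_apply] <;> linarith

/-! ### Light-like vectors and Möbius maps -/

/-- Homogeneous coordinates of a point of the extended complex plane. -/
def ray : OnePoint ℂ → Fin 2 → ℂ
  | none => ![1, 0]
  | some z => ![z, 1]

lemma light_infty : light OnePoint.infty = ![1, 0, 0, 1] := rfl

lemma light_coe (z : ℂ) : light (z : OnePoint ℂ) =
    ![Complex.normSq z + 1, 2 * z.re, 2 * z.im, Complex.normSq z - 1] := rfl

lemma ray_infty : ray OnePoint.infty = ![1, 0] := rfl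

lemma ray_coe (z : ℂ) : ray (z : OnePoint ℂ) = ![z, 1] := rfl

lemma herm_light (p : OnePoint ℂ) :
    herm (light p) = (2 : ℂ) • vecMulVec (ray p) (star (ray p)) := by
  ext i j
  rw [Matrix.smul_apply, vecMulVec_apply, Pi.star_apply]
  induction p using OnePoint.rec with
  | infty =>
    fin_cases i <;> fin_cases j <;> simp [light_infty, ray_infty, herm_apply]
    norm_num
  | coe z =>
    fin_cases i <;> fin_cases j <;> apply Complex.ext <;>
      simp [light_coe, ray_coe, herm_apply, Complex.normSq_apply] <;> ring

lemma exists_mulVec_ray (A : GL (Fin 2) ℂ) (p : OnePoint ℂ) :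
    ∃ μ : ℂ, μ ≠ 0 ∧ (A : Matrix (Fin 2) (Fin 2) ℂ) *ᵥ ray p = μ • ray (A • p) := by
  have hdet := A.det_ne_zero
  rw [det_fin_two] at hdet
  induction p using OnePoint.rec with
  | infty =>
    rw [OnePoint.smul_infty_eq_ite]
    split_ifs with h
    · refine ⟨A 0 0, fun h0 => hdet (by simp [h, h0]), ?_⟩
      ext i; fin_cases i <;> simp [ray_infty, mulVec, dotProduct, Fin.sum_univ_two, h]
    · refine ⟨A 1 0, h, ?_⟩
      ext i; fin_cases i <;>
        simp [ray_infty, ray_coe, mulVec, dotProduct, Fin.sum_univ_two]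
      field_simp
  | coe z =>
    rw [OnePoint.smul_some_eq_ite]
    split_ifs with h
    · refine ⟨A 0 0 * z + A 0 1, fun h0 => hdet ?_, ?_⟩
      · by_cases hc : A 1 0 = 0
        · have hd : A 1 1 = 0 := by simpa [hc] using h
          simp [hc, hd]
        · apply mul_left_cancel₀ hc
          linear_combination A 1 0 * A 0 0 * h - (A 1 0) ^ 2 * h0
      · ext i; fin_cases i <;> simp [ray_infty, ray_coe, mulVec, dotProduct, Fin.sum_univ_two, h]
    · refine ⟨A 1 0 * z + A 1 1, h, ?_⟩
      ext i; fin_cases i <;>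
        simp [ray_coe, mulVec, dotProduct, Fin.sum_univ_two]
      rw [mul_div_cancel₀ _ h]

lemma mul_herm_light (A : GL (Fin 2) ℂ) (p : OnePoint ℂ) :
    ∃ s : ℝ, 0 < s ∧ (A : Matrix (Fin 2) (Fin 2) ℂ) * herm (light p) *
      (A : Matrix (Fin 2) (Fin 2) ℂ)ᴴ = s • herm (light (A • p)) := by
  obtain ⟨μ, hμ, h⟩ := exists_mulVec_ray A p
  refine ⟨Complex.normSq μ, Complex.normSq_pos.2 hμ, ?_⟩
  rw [herm_light, herm_light, Matrix.mul_smul, Matrix.smul_mul, mul_vecMulVec, vecMulVec_mul,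
    ← star_mulVec, h, star_smul, smul_vecMulVec, vecMulVec_smul, ← Complex.coe_smul,
    Complex.normSq_eq_conj_mul_self]
  simp only [smul_smul]
  congr 1
  rw [← starRingEnd_apply]
  ring

/-! ### From the boundary action to the linear action -/

/-- `f` acts on Hermitian matrices by `H ↦ |det A|⁻¹ A H A*`. -/
def ActsBy (f : Isom) (A : Matrix (Fin 2) (Fin 2) ℂ) : Prop :=
  ∀ v, herm (lin f v) = ‖A.det‖⁻¹ • (A * herm v * Aᴴ)

/-- `f` acts on Hermitian matrices by `H ↦ |det A|⁻¹ A H̄ A*`. -/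
def ActsByConj (f : Isom) (A : Matrix (Fin 2) (Fin 2) ℂ) : Prop :=
  ∀ v, herm (lin f v) = ‖A.det‖⁻¹ • (A * (herm v)ᵀ * Aᴴ)

/-- A linear map having enough light-like vectors as eigenvectors is a homothety. -/
lemma exists_smul_of_light (K : V →ₗ[ℝ] Matrix (Fin 2) (Fin 2) ℂ)
    (h : ∀ p, ∃ s : ℝ, 0 < s ∧ K (light p) = s • herm (light p)) :
    ∃ s : ℝ, 0 < s ∧ ∀ v, K v = s • herm v := by
  obtain ⟨a, ha, h1⟩ := h OnePoint.infty
  obtain ⟨b, -, h2⟩ := h ((0 : ℂ) : OnePoint ℂ)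
  obtain ⟨c, -, h3⟩ := h ((1 : ℂ) : OnePoint ℂ)
  obtain ⟨d, -, h4⟩ := h ((-1 : ℂ) : OnePoint ℂ)
  obtain ⟨e, -, h5⟩ := h ((Complex.I : ℂ) : OnePoint ℂ)
  obtain ⟨g, -, h6⟩ := h ((-Complex.I : ℂ) : OnePoint ℂ)
  -- The light vectors over `∞, 0, 1, i` form a basis. These two linear relations tie their
  -- eigenvalues together, so all are equal.
  have r1 : light ((1 : ℂ) : OnePoint ℂ) + light ((-1 : ℂ) : OnePoint ℂ) =
      (2 : ℝ) • (light OnePoint.infty + light ((0 : ℂ) : OnePoint ℂ)) := by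
    ext i; fin_cases i <;> simp [light_infty, light_coe]; norm_num
  have r2 : light ((Complex.I : ℂ) : OnePoint ℂ) + light ((-Complex.I : ℂ) : OnePoint ℂ) =
      (2 : ℝ) • (light OnePoint.infty + light ((0 : ℂ) : OnePoint ℂ)) := by
    ext i; fin_cases i <;> simp [light_infty, light_coe]; norm_num
  have k1 := congrArg K r1
  have k2 := congrArg K r2
  rw [map_add, map_smul, map_add, h3, h4, h1, h2] at k1
  rw [map_add, map_smul, map_add, h5, h6, h1, h2] at k2
  simp only [← map_smul, ← map_add] at k1 k2
  have k1 := herm_injective k1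
  have k2 := herm_injective k2
  have e10 := congrFun k1 0
  have e11 := congrFun k1 1
  have e13 := congrFun k1 3
  have e20 := congrFun k2 0
  have e22 := congrFun k2 2
  simp [light_infty, light_coe] at e10 e11 e13 e20 e22
  have hb : b = a := by linarith
  have hc : c = a := by linarith
  have he : e = a := by linarith
  subst hb
  subst hc
  subst he
  refine ⟨e, ha, fun v => ?_⟩
  have hv : v = ((v 0 + v 3 - v 1 - v 2) / 2) • light OnePoint.infty +
      ((v 0 - v 3 - v 1 - v 2) / 2) • light ((0 : ℂ) : OnePoint ℂ) +
      (v 1 / 2) • light ((1 : ℂ) : OnePoint ℂ) +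
      (v 2 / 2) • light ((Complex.I : ℂ) : OnePoint ℂ) := by
    ext i; fin_cases i <;> simp [light_infty, light_coe] <;> ring
  rw [hv]
  simp only [map_add, map_smul, h1, h2, h3, h5, smul_add]
  simp only [smul_comm e]

lemma Q_lin (f : Isom) (v : V) : Q (lin f v) = Q v := f.2.1 v

lemma lin_mul (f g : Isom) (v : V) : lin (f * g) v = lin f (lin g v) := rfl

lemma actsBy_of_boundaryMap {f : Isom} {A : GL (Fin 2) ℂ}
    (h : BoundaryMap f (fun z => A • z)) : ActsBy f A := by
  set M : Matrix (Fin 2) (Fin 2) ℂ := (A : Matrix (Fin 2) (Fin 2) ℂ) with hM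
  have hdet : M.det ≠ 0 := A.det_ne_zero
  have hu : IsUnit M.det := isUnit_iff_ne_zero.2 hdet
  have hu' : IsUnit Mᴴ.det := by rw [det_conjTranspose]; exact hu.star
  let K : V →ₗ[ℝ] Matrix (Fin 2) (Fin 2) ℂ :=
    { toFun := fun v => M⁻¹ * herm (lin f v) * Mᴴ⁻¹
      map_add' := fun v w => by simp [mul_add, add_mul]
      map_smul' := fun t v => by simp }
  have hK : ∀ v, herm (lin f v) = M * K v * Mᴴ := fun v => by
    change _ = M * (M⁻¹ * herm (lin f v) * Mᴴ⁻¹) * Mᴴ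
    rw [mul_assoc, mul_assoc, Matrix.nonsing_inv_mul _ hu', mul_one, ← mul_assoc,
      Matrix.mul_nonsing_inv _ hu, one_mul]
  obtain ⟨s, hs, hs'⟩ := exists_smul_of_light K fun p => by
    obtain ⟨t, ht, h1⟩ := h p
    obtain ⟨r, hr, h2⟩ := mul_herm_light A p
    refine ⟨t / r, div_pos ht hr, ?_⟩
    have h3 : herm (light (A • p)) = r⁻¹ • (M * herm (light p) * Mᴴ) := by
      rw [h2, smul_smul, inv_mul_cancel₀ hr.ne', one_smul]
    change M⁻¹ * herm (lin f (light p)) * Mᴴ⁻¹ = _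
    rw [h1, map_smul, h3, smul_smul, div_eq_mul_inv, Matrix.mul_smul, Matrix.smul_mul]
    congr 1
    rw [← mul_assoc, ← mul_assoc, Matrix.nonsing_inv_mul _ hu, one_mul, mul_assoc,
      Matrix.mul_nonsing_inv _ hu', mul_one]
  have key : ∀ v, herm (lin f v) = s • (M * herm v * Mᴴ) := fun v => by
    rw [hK, hs', Matrix.mul_smul, Matrix.smul_mul]
  -- The test vector corresponds to the identity matrix; since `f` preserves the determinant, `s²
  -- |det M|² = 1`.
  have hs1 : s = ‖M.det‖⁻¹ := by
    have h1 := congrArg det (key ![1, 0, 0, 0])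
    rw [det_herm, Q_lin, ← det_herm, ← Complex.coe_smul, det_smul, det_mul, det_mul,
      det_conjTranspose, det_herm] at h1
    have h2 : Q ![1, 0, 0, 0] = 1 := by simp [Q]
    have h4 : M.det * star M.det = ((‖M.det‖ ^ 2 : ℝ) : ℂ) := by
      have := Complex.mul_conj' M.det
      push_cast
      exact this
    have h3 : 1 = (s * ‖M.det‖) ^ 2 := by
      rw [h2] at h1
      apply Complex.ofReal_injective
      simp only [Fintype.card_fin, mul_pow, Complex.ofReal_mul, Complex.ofReal_pow] at h1 h4 ⊢
      rw [← h4]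
      rw [Complex.ofReal_one] at h1 ⊢
      linear_combination h1
    have hn : 0 < ‖M.det‖ := norm_pos_iff.2 hdet
    have h5 : s * ‖M.det‖ = 1 := by
      have := mul_pos hs hn
      nlinarith
    exact eq_inv_of_mul_eq_one_left h5
  intro v
  rw [key, hs1]

/-- The reflection of hyperbolic space that induces complex conjugation. -/
def conjIsom : Isom :=
  ⟨LinearEquiv.ofInvolutive
    { toFun := fun v : V => ![v 0, v 1, -v 2, v 3]
      map_add' := fun v w => by ext i; fin_cases i <;> simp; ring
      map_smul' := fun t v => by ext i; fin_cases i <;> simp }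
    (fun v => by ext i; fin_cases i <;> simp),
    ⟨fun v => show Q ![v 0, v 1, -v 2, v 3] = Q v by simp [Q],
      fun v => show ![v 0, v 1, -v 2, v 3] ∈ sheet ↔ v ∈ sheet by simp [Q, sheet]⟩⟩

lemma lin_conjIsom (v : V) : lin conjIsom v = ![v 0, v 1, -v 2, v 3] := rfl

lemma herm_conjIsom (v : V) : herm (lin conjIsom v) = (herm v)ᵀ := by
  ext i j
  fin_cases i <;> fin_cases j <;> simp [lin_conjIsom, herm_apply]; ring

lemma lin_conjIsom_light (p : OnePoint ℂ) : lin conjIsom (light p) = light (conjHat p) := by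
  induction p using OnePoint.rec with
  | infty =>
    change _ = light OnePoint.infty
    ext i; fin_cases i <;> simp [light_infty, lin_conjIsom]
  | coe z =>
    change _ = light ((conj z : ℂ) : OnePoint ℂ)
    ext i; fin_cases i <;> simp [light_coe, lin_conjIsom]

lemma conjHat_conjHat (p : OnePoint ℂ) : conjHat (conjHat p) = p := by
  induction p using OnePoint.rec with
  | infty => rfl
  | coe z =>
    change ((conj (conj z) : ℂ) : OnePoint ℂ) = _
    rw [Complex.conj_conj]

lemma actsByConj_of_boundaryMap {f : Isom} {A : GL (Fin 2) ℂ}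
    (h : BoundaryMap f (fun z => A • conjHat z)) : ActsByConj f A := by
  -- Precomposing with the reflection `conjIsom` cancels the conjugation on the boundary, and
  -- `conjIsom` is transposition on Hermitian matrices.
  have h1 : ActsBy (f * conjIsom) A := actsBy_of_boundaryMap fun p => by
    obtain ⟨t, ht, h2⟩ := h (conjHat p)
    refine ⟨t, ht, ?_⟩
    rw [lin_mul, lin_conjIsom_light, h2]
    simp only [conjHat_conjHat]
  intro v
  have h2 := h1 (lin conjIsom v)
  rw [lin_mul, herm_conjIsom, ← lin_mul conjIsom] at h2
  have h3 : lin (conjIsom * conjIsom) v = v := by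
    rw [lin_mul, lin_conjIsom, lin_conjIsom]
    ext i; fin_cases i <;> simp
  rwa [h3] at h2

/-! ### Characteristic polynomials -/

/-- The entries of a `2 × 2` matrix, as a vector. -/
def entries (M : Matrix (Fin 2) (Fin 2) ℂ) : Fin 4 → ℂ := ![M 0 0, M 0 1, M 1 0, M 1 1]

lemma charpoly_eq_of_mul_eq {n R : Type*} [Fintype n] [DecidableEq n] [CommRing R]
    {M K P S : Matrix n n R} (hPS : P * S = 1) (h : P * M = K * P) : M.charpoly = K.charpoly := by
  have hSP : S * P = 1 := mul_eq_one_comm.1 hPS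
  have hM : M = S * K * P := by rw [mul_assoc, ← h, ← mul_assoc, hSP, one_mul]
  let U : (Matrix n n R)ˣ := ⟨P, S, hPS, hSP⟩
  have hU := Matrix.charpoly_units_conj' U K
  rw [Matrix.inv_eq_left_inv (show S * (U : Matrix n n R) = 1 from hSP)] at hU
  rw [hM, ← hU]

/-- The change of coordinates from `V` to the entries of a Hermitian matrix. -/
def entriesMatrix : Matrix (Fin 4) (Fin 4) ℂ :=
  !![1, 0, 0, 1; 0, 1, Complex.I, 0; 0, 1, -Complex.I, 0; 1, 0, 0, -1]

lemma exists_entriesMatrix_mul_eq_one : ∃ S, entriesMatrix * S = 1 := by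
  refine ⟨!![1 / 2, 0, 0, 1 / 2; 0, 1 / 2, 1 / 2, 0; 0, -Complex.I / 2, Complex.I / 2, 0;
      1 / 2, 0, 0, -1 / 2], ?_⟩
  have hI := Complex.I_mul_I
  ext i j
  rw [Matrix.mul_apply, Fin.sum_univ_four]
  fin_cases i <;> fin_cases j <;> simp [entriesMatrix] <;> grind

lemma entries_herm (v : V) :
    entries (herm v) = entriesMatrix *ᵥ (fun i => (v i : ℂ)) := by
  ext i
  rw [mulVec, dotProduct, Fin.sum_univ_four]
  fin_cases i <;> simp [entries, herm_apply, entriesMatrix] <;> ring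

/-- The entries of a Hermitian matrix are complex linear coordinates on the complexification of `V`,
so the two matrices are conjugate over `ℂ`. -/
lemma charpoly_map_of_entries (T : V →ₗ[ℝ] V) (K : Matrix (Fin 4) (Fin 4) ℂ)
    (h : ∀ v, entries (herm (T v)) = K *ᵥ entries (herm v)) :
    T.charpoly.map Complex.ofRealHom = K.charpoly := by
  have h1 : entriesMatrix * (LinearMap.toMatrix' T).map Complex.ofRealHom = K * entriesMatrix := by
    apply Matrix.ext_of_mulVec_single
    intro i
    have h2 := h (Pi.single i 1)
    have h3 : (fun j => ((Pi.single i 1 : V) j : ℂ)) = Pi.single i 1 := by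
      ext j
      by_cases hj : j = i
      · subst hj; simp
      · simp [hj]
    rw [entries_herm, entries_herm, h3] at h2
    rw [← mulVec_mulVec, ← mulVec_mulVec, ← h2]
    congr 1
    ext j
    simp [LinearMap.toMatrix'_apply]
  obtain ⟨S, hS⟩ := exists_entriesMatrix_mul_eq_one
  have h4 : T.charpoly = (LinearMap.toMatrix' T).charpoly := by
    rw [← Matrix.charpoly_toLin', Matrix.toLin'_toMatrix']
  rw [h4, ← Matrix.charpoly_map, charpoly_eq_of_mul_eq hS h1]

/-- The matrix is `k (A ⊗ A')`, with eigenvalues `k λᵢ λ'ⱼ`; the coefficients are their symmetric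
functions. -/
lemma charpoly_kronecker {R : Type*} [CommRing R] (k a b c d a' b' c' d' : R) :
    (!![k * (a * a'), k * (a * b'), k * (b * a'), k * (b * b');
      k * (a * c'), k * (a * d'), k * (b * c'), k * (b * d');
      k * (c * a'), k * (c * b'), k * (d * a'), k * (d * b');
      k * (c * c'), k * (c * d'), k * (d * c'), k * (d * d')] :
      Matrix (Fin 4) (Fin 4) R).charpoly =
    X ^ 4 - C (k * ((a + d) * (a' + d'))) * X ^ 3 +
      C (k ^ 2 * ((a + d) ^ 2 * (a' * d' - b' * c') + (a' + d') ^ 2 * (a * d - b * c) -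
        2 * (a * d - b * c) * (a' * d' - b' * c'))) * X ^ 2 -
      C (k ^ 3 * ((a + d) * (a' + d')) * ((a * d - b * c) * (a' * d' - b' * c'))) * X +
      C (k ^ 4 * ((a * d - b * c) * (a' * d' - b' * c')) ^ 2) := by
  have h2 : (C 2 : R[X]) = 2 := map_ofNat C 2
  rw [Matrix.charpoly, Matrix.charmatrix, Matrix.det_succ_row_zero]
  simp [Fin.sum_univ_succ, Matrix.det_succ_row_zero, Fin.succAbove, Matrix.submatrix, h2]
  ring

/-- The matrix is `T = k (A ⊗ A')` composed with the flip of the two factors, as transposition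
exchanges the off-diagonal entries. Since `T² = k² (A A' ⊗ A' A)`, the eigenvalues should be `kλ`,
`kμ` and `± k √(λμ)`, with `λ, μ` those of `A A'`; the determinant expansion confirms it. -/
lemma charpoly_kronecker_swap {R : Type*} [CommRing R] (k a b c d a' b' c' d' : R) :
    (!![k * (a * a'), k * (b * a'), k * (a * b'), k * (b * b');
      k * (a * c'), k * (b * c'), k * (a * d'), k * (b * d');
      k * (c * a'), k * (d * a'), k * (c * b'), k * (d * b');
      k * (c * c'), k * (d * c'), k * (c * d'), k * (d * d')] :
      Matrix (Fin 4) (Fin 4) R).charpoly =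
    (X ^ 2 - C (k ^ 2 * ((a * d - b * c) * (a' * d' - b' * c')))) *
      (X ^ 2 - C (k * (a * a' + b * c' + c * b' + d * d')) * X +
        C (k ^ 2 * ((a * d - b * c) * (a' * d' - b' * c')))) := by
  rw [Matrix.charpoly, Matrix.charmatrix, Matrix.det_succ_row_zero]
  simp [Fin.sum_univ_succ, Matrix.det_succ_row_zero, Fin.succAbove, Matrix.submatrix]
  ring

/-- The real number `tr (A Ā) / |det A|`. -/
def sqTrace (A : Matrix (Fin 2) (Fin 2) ℂ) : ℝ :=
  (A * A.map (starRingEnd ℂ)).trace.re / ‖A.det‖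

lemma trace_mul_map_conj (A : Matrix (Fin 2) (Fin 2) ℂ) :
    (A * A.map (starRingEnd ℂ)).trace = A 0 0 * conj (A 0 0) + A 0 1 * conj (A 1 0) +
      A 1 0 * conj (A 0 1) + A 1 1 * conj (A 1 1) := by
  simp [trace_fin_two, Matrix.mul_apply, Fin.sum_univ_two]
  ring

lemma trace_mul_map_conj_eq_ofReal {A : Matrix (Fin 2) (Fin 2) ℂ} (hA : A.det ≠ 0) :
    (A * A.map (starRingEnd ℂ)).trace = ((sqTrace A * ‖A.det‖ : ℝ) : ℂ) := by
  have hn : ‖A.det‖ ≠ 0 := norm_ne_zero_iff.2 hA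
  rw [sqTrace, div_mul_cancel₀ _ hn]
  apply Complex.ext
  · simp
  · rw [trace_mul_map_conj]
    simp
    ring

lemma det_map_conj (A : Matrix (Fin 2) (Fin 2) ℂ) :
    (A.map (starRingEnd ℂ)).det = conj A.det := by
  simp [det_fin_two]

lemma det_mul_map_conj (A : Matrix (Fin 2) (Fin 2) ℂ) :
    (A * A.map (starRingEnd ℂ)).det = ((‖A.det‖ ^ 2 : ℝ) : ℂ) := by
  rw [det_mul, det_map_conj, Complex.mul_conj']
  push_cast
  rfl

lemma cInv_mul_map_conj {A : Matrix (Fin 2) (Fin 2) ℂ} (hA : A.det ≠ 0) :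
    cInv (A * A.map (starRingEnd ℂ)) = ((sqTrace A ^ 2 : ℝ) : ℂ) := by
  have hn : ‖A.det‖ ≠ 0 := norm_ne_zero_iff.2 hA
  rw [cInv, trace_mul_map_conj_eq_ofReal hA, det_mul_map_conj, ← Complex.ofReal_pow,
    ← Complex.ofReal_div]
  congr 1
  field_simp

lemma ActsByConj.mul_self {f : Isom} {A : Matrix (Fin 2) (Fin 2) ℂ} (h : ActsByConj f A) :
    ActsBy (f * f) (A * A.map (starRingEnd ℂ)) := by
  intro v
  have h1 : (A.map (starRingEnd ℂ)) = Aᴴᵀ := rfl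
  rw [lin_mul, h, h, det_mul_map_conj, Complex.norm_real, Real.norm_of_nonneg (by positivity),
    transpose_smul, Matrix.mul_smul, Matrix.smul_mul, smul_smul, transpose_mul, transpose_mul,
    transpose_transpose, conjTranspose_mul, h1]
  congr 1
  · rw [sq, mul_inv]
  · have h2 : (Aᴴᵀ)ᴴ = Aᵀ := by ext; simp
    rw [h2]
    simp only [mul_assoc]

lemma ActsBy.charpoly_eq {f : Isom} {A : Matrix (Fin 2) (Fin 2) ℂ} (h : ActsBy f A)
    (hA : A.det ≠ 0) :
    (lin f).charpoly = X ^ 4 - C ‖cInv A‖ * X ^ 3 + C (2 * (cInv A).re - 2) * X ^ 2 -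
      C ‖cInv A‖ * X + 1 := by
  apply Polynomial.map_injective Complex.ofRealHom Complex.ofReal_injective
  have hn : (‖A.det‖ : ℂ) ≠ 0 := by exact_mod_cast norm_ne_zero_iff.2 hA
  have hd : A.det * conj A.det = (‖A.det‖ : ℂ) ^ 2 := Complex.mul_conj' _
  have ht : A.trace * conj A.trace = (‖A.trace‖ : ℂ) ^ 2 := Complex.mul_conj' _
  have hc : (‖cInv A‖ : ℂ) = (‖A.det‖ : ℂ)⁻¹ * (A.trace * conj A.trace) := by
    rw [cInv, norm_div, norm_pow, ht]
    push_cast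
    field_simp
  have hre : ((2 * (cInv A).re - 2 : ℝ) : ℂ) = (‖A.det‖ : ℂ)⁻¹ ^ 2 * (A.trace ^ 2 * conj A.det +
      conj A.trace ^ 2 * A.det - 2 * A.det * conj A.det) := by
    have h1 : ((2 * (cInv A).re : ℝ) : ℂ) = cInv A + conj (cInv A) := by
      rw [Complex.add_conj]
    have hd' : conj A.det ≠ 0 := by simpa using hA
    rw [Complex.ofReal_sub, h1, cInv, map_div₀, map_pow, inv_pow, ← hd]
    push_cast
    field_simp
  rw [charpoly_map_of_entries (lin f) _ fun v => ?_,
    charpoly_kronecker (‖A.det‖ : ℂ)⁻¹ (A 0 0) (A 0 1) (A 1 0) (A 1 1)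
      (conj (A 0 0)) (conj (A 0 1)) (conj (A 1 0)) (conj (A 1 1))]
  · have e1 : A 0 0 + A 1 1 = A.trace := (trace_fin_two A).symm
    have e2 : conj (A 0 0) + conj (A 1 1) = conj A.trace := by rw [← map_add, e1]
    have e3 : A 0 0 * A 1 1 - A 0 1 * A 1 0 = A.det := (det_fin_two A).symm
    have e4 : conj (A 0 0) * conj (A 1 1) - conj (A 0 1) * conj (A 1 0) = conj A.det := by
      rw [← e3]; simp
    rw [e1, e2, e3, e4, mul_assoc 2, ← mul_assoc 2, ← hre]
    have e5 : (‖A.det‖ : ℂ)⁻¹ ^ 3 * (A.trace * conj A.trace) * (A.det * conj A.det) =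
        (‖cInv A‖ : ℂ) := by
      rw [hc, hd]; field_simp
    have e6 : (‖A.det‖ : ℂ)⁻¹ ^ 4 * (A.det * conj A.det) ^ 2 = 1 := by
      rw [hd]; field_simp
    rw [e5, e6, ← hc]
    simp
  · rw [h v]
    ext i
    rw [mulVec, dotProduct, Fin.sum_univ_four]
    fin_cases i <;>
      simp [entries, Matrix.mul_apply, Fin.sum_univ_two, conjTranspose_apply] <;> ring

lemma ActsByConj.charpoly_eq {f : Isom} {A : Matrix (Fin 2) (Fin 2) ℂ} (h : ActsByConj f A)
    (hA : A.det ≠ 0) :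
    (lin f).charpoly = (X ^ 2 - 1) * (X ^ 2 - C (sqTrace A) * X + 1) := by
  apply Polynomial.map_injective Complex.ofRealHom Complex.ofReal_injective
  have hn : (‖A.det‖ : ℂ) ≠ 0 := by exact_mod_cast norm_ne_zero_iff.2 hA
  have hd : A.det * conj A.det = (‖A.det‖ : ℂ) ^ 2 := Complex.mul_conj' _
  rw [charpoly_map_of_entries (lin f) _ fun v => ?_,
    charpoly_kronecker_swap (‖A.det‖ : ℂ)⁻¹ (A 0 0) (A 0 1) (A 1 0) (A 1 1)
      (conj (A 0 0)) (conj (A 0 1)) (conj (A 1 0)) (conj (A 1 1))]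
  · have e3 : A 0 0 * A 1 1 - A 0 1 * A 1 0 = A.det := (det_fin_two A).symm
    have e4 : conj (A 0 0) * conj (A 1 1) - conj (A 0 1) * conj (A 1 0) = conj A.det := by
      rw [← e3]; simp
    have e6 : (‖A.det‖ : ℂ)⁻¹ ^ 2 * (A.det * conj A.det) = 1 := by
      rw [hd]; field_simp
    rw [e3, e4, e6, ← trace_mul_map_conj, trace_mul_map_conj_eq_ofReal hA]
    have e7 : (‖A.det‖ : ℂ)⁻¹ * ((sqTrace A * ‖A.det‖ : ℝ) : ℂ) = (sqTrace A : ℂ) := by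
      push_cast
      field_simp
    rw [e7]
    simp
  · rw [h v]
    ext i
    rw [mulVec, dotProduct, Fin.sum_univ_four]
    fin_cases i <;>
      simp [entries, Matrix.mul_apply, Fin.sum_univ_two, conjTranspose_apply] <;> ring

/-! ### Time-like fixed vectors -/

/-- In the application `N` is the traceless part of `M`, a half-turn about the axis of the rotation
`M`. The matrix `κ + N N*` is, up to scale, the midpoint of the origin and its image under `N`,
hence lies on that axis and is fixed by `M`. -/
lemma mul_mul_conjTranspose_of_sq {M N : Matrix (Fin 2) (Fin 2) ℂ} {t d : ℂ} {κ σ : ℝ}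
    (hM : M = t • 1 + N) (hN : N * N = (-(d * σ)) • (1 : Matrix (Fin 2) (Fin 2) ℂ))
    (hκ : (κ : ℂ) ^ 2 = d * conj d * σ ^ 2) (ht : t * κ = conj t * (d * σ)) :
    M * ((κ : ℂ) • 1 + N * Nᴴ) * Mᴴ = (t * conj t + κ) • ((κ : ℂ) • 1 + N * Nᴴ) := by
  have hN' : Nᴴ * Nᴴ = (-(conj d * σ)) • (1 : Matrix (Fin 2) (Fin 2) ℂ) := by
    rw [← conjTranspose_mul, hN, conjTranspose_smul, conjTranspose_one]
    congr 1
    simp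
  have ht' : conj t * κ = t * (conj d * σ) := by
    have := congrArg (starRingEnd ℂ) ht
    simpa using this
  have hM' : Mᴴ = conj t • 1 + Nᴴ := by
    rw [hM, conjTranspose_add, conjTranspose_smul, conjTranspose_one]
    rfl
  have e1 : N * (N * Nᴴ) = (-(d * σ)) • Nᴴ := by rw [← mul_assoc, hN, smul_one_mul]
  have e2 : N * Nᴴ * Nᴴ = (-(conj d * σ)) • N := by rw [mul_assoc, hN', mul_smul_one]
  rw [hM', hM]
  simp only [mul_add, add_mul, Matrix.smul_mul, Matrix.mul_smul, one_mul, mul_one, smul_add, e1, e2,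
    hN', smul_smul]
  have c1 : conj t * -(d * σ) = -(t * κ) := by rw [ht]; ring
  have c2 : t * -(conj d * σ) = -(conj t * κ) := by rw [ht']; ring
  have c3 : -(d * σ) * -(conj d * σ) = (κ : ℂ) * κ := by linear_combination -hκ
  rw [c1, c2, c3]
  module

open scoped ComplexOrder in
/-- A Möbius map with `0 ≤ c < 4` fixes a point of hyperbolic space. -/
lemma exists_posDef_of_cInv {M : Matrix (Fin 2) (Fin 2) ℂ} (hd : M.det ≠ 0) {x : ℝ}
    (hx : cInv M = x) (hx0 : 0 ≤ x) (hx4 : x < 4) :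
    ∃ v, 0 < Q v ∧ M * herm v * Mᴴ = ‖M.det‖ • herm v := by
  set σ : ℝ := 1 - x / 4 with hσ
  set t : ℂ := M.trace / 2 with ht
  set κ : ℝ := ‖M.det‖ * σ with hκ
  have hn : 0 < ‖M.det‖ := norm_pos_iff.2 hd
  have hκ0 : 0 < κ := mul_pos hn (by rw [hσ]; linarith)
  have htd : t ^ 2 = x / 4 * M.det := by
    rw [cInv, div_eq_iff hd] at hx
    rw [ht, div_pow, hx]; ring
  have hdd : M.det * conj M.det = (‖M.det‖ : ℂ) ^ 2 := Complex.mul_conj' _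
  have htt : t * conj t = ((x / 4 * ‖M.det‖ : ℝ) : ℂ) := by
    rw [Complex.mul_conj', ← Complex.ofReal_pow, ← norm_pow, htd, norm_mul]
    norm_cast
    rw [Real.norm_of_nonneg (by positivity)]
  -- This says that `t² / det M` is a non-negative real, which is what `0 ≤ c` provides.
  have ht' : t * κ = conj t * (M.det * σ) := by
    by_cases h0 : t = 0
    · simp [h0]
    · apply mul_left_cancel₀ h0
      rw [hκ]
      push_cast at htt ⊢
      linear_combination (‖M.det‖ : ℂ) * σ * htd - M.det * σ * htt
  set N := M - t • (1 : Matrix (Fin 2) (Fin 2) ℂ) with hNdef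
  -- Cayley–Hamilton for the traceless `N`, whose determinant is `det M - t² = σ det M`.
  have hN : N * N = (-(M.det * σ)) • (1 : Matrix (Fin 2) (Fin 2) ℂ) := by
    have hσ' : (σ : ℂ) = 1 - x / 4 := by rw [hσ]; push_cast; rfl
    have h1 : M.det * σ = M.det - t ^ 2 := by rw [htd, hσ']; ring
    rw [h1, ht, trace_fin_two, det_fin_two]
    ext i j
    fin_cases i <;> fin_cases j <;>
      simp [hNdef, Matrix.mul_apply, Fin.sum_univ_two, ht, trace_fin_two] <;> ring
  have hM : M = t • 1 + N := by rw [hNdef]; abel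
  have key := mul_mul_conjTranspose_of_sq (κ := κ) hM hN
    (by rw [hdd, hκ]; push_cast; ring) ht'
  have hpd : ((κ : ℂ) • 1 + N * Nᴴ).PosDef := by
    apply PosDef.add_posSemidef
    · exact PosDef.one.smul (by exact_mod_cast hκ0)
    · exact posSemidef_self_mul_conjTranspose N
  obtain ⟨v, hv⟩ := exists_herm_eq hpd.isHermitian.eq
  refine ⟨v, ?_, ?_⟩
  · have h2 := hpd.det_pos
    rw [← hv, det_herm] at h2
    exact_mod_cast h2
  · rw [hv, key, htt, ← Complex.coe_smul]
    congr 1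
    rw [hκ, hσ]
    push_cast
    ring

lemma ActsBy.exists_timelike_fixed {f : Isom} {M : Matrix (Fin 2) (Fin 2) ℂ} (h : ActsBy f M)
    (hd : M.det ≠ 0) {x : ℝ} (hx : cInv M = x) (hx0 : 0 ≤ x) (hx4 : x < 4) :
    ∃ v, 0 < Q v ∧ lin f v = v := by
  obtain ⟨v, hv, h1⟩ := exists_posDef_of_cInv hd hx hx0 hx4
  refine ⟨v, hv, herm_injective ?_⟩
  rw [h, h1, smul_smul, inv_mul_cancel₀ (norm_ne_zero_iff.2 hd), one_smul]

lemma Q_smul (t : ℝ) (v : V) : Q (t • v) = t ^ 2 * Q v := by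
  simp [Q]; ring

lemma pos_of_timelike (f : Isom) {v : V} (hQ : 0 < Q v) (h0 : 0 < v 0) : 0 < lin f v 0 := by
  have hs : 0 < Real.sqrt (Q v) := Real.sqrt_pos.2 hQ
  have h1 : (Real.sqrt (Q v))⁻¹ • v ∈ sheet := by
    refine ⟨?_, ?_⟩
    · rw [Q_smul, inv_pow, Real.sq_sqrt hQ.le, inv_mul_cancel₀ hQ.ne']
    · exact mul_pos (inv_pos.2 hs) h0
  have h2 : lin f ((Real.sqrt (Q v))⁻¹ • v) ∈ sheet := (f.2.2 _).2 h1
  rw [map_smul] at h2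
  exact (mul_pos_iff_of_pos_left (inv_pos.2 hs)).1 h2.2

/-- Convexity of the open future cone, by the Cauchy–Schwarz inequality on the space coordinates. -/
lemma Q_add_pos {v w : V} (hv : 0 < Q v) (hv0 : 0 < v 0) (hw : 0 < Q w) (hw0 : 0 < w 0) :
    0 < Q (v + w) := by
  have h1 : (v 1 * w 1 + v 2 * w 2 + v 3 * w 3) ^ 2 < (v 0 * w 0) ^ 2 := by
    simp only [Q] at hv hw
    have h3 : (v 1 * w 1 + v 2 * w 2 + v 3 * w 3) ^ 2 ≤
        (v 1 ^ 2 + v 2 ^ 2 + v 3 ^ 2) * (w 1 ^ 2 + w 2 ^ 2 + w 3 ^ 2) := by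
      nlinarith [sq_nonneg (v 1 * w 2 - v 2 * w 1), sq_nonneg (v 1 * w 3 - v 3 * w 1),
        sq_nonneg (v 2 * w 3 - v 3 * w 2)]
    have h4 : (v 1 ^ 2 + v 2 ^ 2 + v 3 ^ 2) * (w 1 ^ 2 + w 2 ^ 2 + w 3 ^ 2) <
        v 0 ^ 2 * w 0 ^ 2 := by
      apply mul_lt_mul'' <;> first | positivity | linarith
    rw [mul_pow]
    linarith
  have h2 := (abs_lt_of_sq_lt_sq' h1 (mul_pos hv0 hw0).le).2
  simp only [Q, Pi.add_apply] at hv hw ⊢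
  nlinarith

/-- With `v` chosen in the future cone, `f v` lies there too, and `v + f v` is time-like and fixed
by `f`. -/
lemma exists_timelike_fixed_of_mul_self {f : Isom} {v : V} (hv : 0 < Q v)
    (h : lin f (lin f v) = v) : ∃ w, 0 < Q w ∧ lin f w = w := by
  wlog h0 : 0 < v 0 generalizing v
  · have hne : v 0 ≠ 0 := by
      intro h1
      simp only [Q, h1] at hv
      nlinarith [sq_nonneg (v 1), sq_nonneg (v 2), sq_nonneg (v 3)]
    refine this (v := -v) (by simpa [Q] using hv) (by simp [h]) ?_
    have := lt_of_le_of_ne (not_lt.1 h0) hne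
    simpa using this
  refine ⟨v + lin f v, Q_add_pos hv h0 (by rwa [Q_lin]) (pos_of_timelike f hv h0), ?_⟩
  rw [map_add, h, add_comm]

/-! ### Scalar matrices and semisimplicity -/

lemma isScalar_of_forall_herm {A : Matrix (Fin 2) (Fin 2) ℂ} {k : ℝ} (hk : k ≠ 0)
    (h : ∀ v, A * herm v * Aᴴ = k • herm v) : IsScalar A := by
  -- The test matrices are `diag(1, 0)`, `diag(0, 1)` and the exchange matrix: the first two make
  -- `A` diagonal, the third equates its diagonal entries.
  have h1 := h ![1 / 2, 0, 0, 1 / 2]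
  have h2 := h ![1 / 2, 0, 0, -1 / 2]
  have h3 := h ![0, 1, 0, 0]
  have a00 := congrFun (congrFun h1 0) 0
  have a11 := congrFun (congrFun h1 1) 1
  have b00 := congrFun (congrFun h2 0) 0
  have c01 := congrFun (congrFun h3 0) 1
  simp [herm_apply, Matrix.mul_apply, Fin.sum_univ_two, conjTranspose_apply] at a00 a11 b00 c01
  norm_num at a00 a11 b00
  replace a00 : A 0 0 * conj (A 0 0) = k := by rw [a00]; ring
  have hk' : (k : ℂ) ≠ 0 := by exact_mod_cast hk
  rw [a11, b00] at c01
  have ha : A 0 0 ≠ 0 := by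
    intro h0
    rw [h0, zero_mul] at a00
    exact hk' a00.symm
  have hda : A 1 1 = A 0 0 := by
    apply (starRingEnd ℂ).injective
    apply mul_left_cancel₀ ha
    rw [a00]
    simpa using c01
  refine ⟨A 0 0, ?_⟩
  ext i j
  fin_cases i <;> fin_cases j <;> simp [a11, b00, hda]

lemma ActsBy.isScalar_of_eq_one {f : Isom} {A : Matrix (Fin 2) (Fin 2) ℂ} (h : ActsBy f A)
    (hA : A.det ≠ 0) (hf : ∀ v, lin f v = v) : IsScalar A := by
  have hn : ‖A.det‖ ≠ 0 := norm_ne_zero_iff.2 hA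
  refine isScalar_of_forall_herm hn fun v => ?_
  have h1 := h v
  rw [hf] at h1
  conv_rhs => rw [h1]
  rw [smul_smul, mul_inv_cancel₀ hn, one_smul]

lemma ActsBy.lin_eq_self_of_isScalar {f : Isom} {A : Matrix (Fin 2) (Fin 2) ℂ} (h : ActsBy f A)
    (hA : A.det ≠ 0) (hs : IsScalar A) (v : V) : lin f v = v := by
  obtain ⟨z, rfl⟩ := hs
  apply herm_injective
  rw [h]
  rw [det_smul, Fintype.card_fin, det_one, mul_one] at hA ⊢
  rw [smul_one_mul, conjTranspose_smul, conjTranspose_one, mul_smul_one, smul_smul, norm_pow,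
    ← Complex.coe_smul, smul_smul]
  have h1 : star z * z = ((‖z‖ ^ 2 : ℝ) : ℂ) := by
    rw [mul_comm]
    push_cast
    exact Complex.mul_conj' z
  have hz : ‖z‖ ^ 2 ≠ 0 := by rw [← norm_pow]; exact norm_ne_zero_iff.2 hA
  rw [h1, ← Complex.ofReal_mul, inv_mul_cancel₀ hz, Complex.ofReal_one, one_smul]

lemma eq_one_of_lin_eq_self {f : Isom} (h : ∀ v, lin f v = v) : f = 1 :=
  Subtype.ext (LinearEquiv.ext h)

/-- A semisimple operator annihilated by a power of `p` is annihilated by `p`. -/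
lemma aeval_eq_zero_of_isSemisimple {T : V →ₗ[ℝ] V} (hT : Module.End.IsSemisimple T) {p : ℝ[X]}
    {n : ℕ} (h : T.charpoly ∣ p ^ n) : aeval T p = 0 := by
  apply Module.End.eq_zero_of_isNilpotent_isSemisimple _ (hT.aeval p)
  obtain ⟨q, hq⟩ := h
  refine ⟨n, ?_⟩
  rw [← map_pow, hq, map_mul, LinearMap.aeval_self_charpoly, zero_mul]

/-! ### Factors of the characteristic polynomial -/

lemma exists_factor_of_two_lt_abs {y : ℝ} (hy : 2 < |y|) : ∃ r : ℝ, r ≠ 1 ∧ r ≠ -1 ∧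
    (X ^ 2 - C y * X + 1 : ℝ[X]) = (X - C r) * (X - C r⁻¹) := by
  have h4 : 0 < y ^ 2 - 4 := by
    have := sq_lt_sq' (by linarith [abs_nonneg y]) hy
    rw [sq_abs] at this
    linarith
  set s := Real.sqrt (y ^ 2 - 4) with hs
  have hss : s ^ 2 = y ^ 2 - 4 := Real.sq_sqrt h4.le
  have h1 : (y + s) / 2 * ((y - s) / 2) = 1 := by linear_combination -hss / 4
  have hinv : ((y + s) / 2)⁻¹ = (y - s) / 2 := inv_eq_of_mul_eq_one_right h1
  have hs0 : 0 < s := Real.sqrt_pos.2 h4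
  refine ⟨(y + s) / 2, fun h => ?_, fun h => ?_, ?_⟩
  · rw [h] at h1; linarith
  · rw [h] at h1; linarith
  · rw [hinv]
    have h2 : (C ((y + s) / 2) + C ((y - s) / 2) : ℝ[X]) = C y := by
      rw [← C_add]; congr 1; ring
    have h3 : (C ((y + s) / 2) * C ((y - s) / 2) : ℝ[X]) = 1 := by
      rw [← C_mul, h1, C_1]
    linear_combination X * h2 - h3

lemma quadratic_pi : (X ^ 2 - C (2 * Real.cos Real.pi) * X + 1 : ℝ[X]) = (X + 1) ^ 2 := by
  have : (C (2 * Real.cos Real.pi) : ℝ[X]) = -2 := by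
    rw [Real.cos_pi, show (2 * -1 : ℝ) = -2 by norm_num, C_neg]; rfl
  rw [this]; ring

lemma hasRotationAngle_pi {f : Isom} {p : ℝ[X]} (h : (lin f).charpoly = (X + 1) ^ 2 * p) :
    HasRotationAngle Real.pi f :=
  ⟨Real.pi_pos, le_rfl, by rw [quadratic_pi, h]; exact dvd_mul_right _ _⟩

lemma eval_neg_one_of_hasRotationAngle_pi {f : Isom} (h : HasRotationAngle Real.pi f) :
    (lin f).charpoly.eval (-1) = 0 := by
  obtain ⟨-, -, q, hq⟩ := h
  rw [hq, quadratic_pi]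
  simp

lemma rotPoly_zero (l m : ℕ) : rotPoly l m 0 = (X - 1) ^ l * (X + 1) ^ m := by
  simp [rotPoly]

lemma rotPoly_singleton (l m : ℕ) (a : ℝ) :
    rotPoly l m {a} = (X - 1) ^ l * (X + 1) ^ m * (X ^ 2 - C (2 * a) * X + 1) := by
  simp [rotPoly]

lemma norm_sub_four_sq (c : ℂ) : ‖c - 4‖ ^ 2 = ‖c‖ ^ 2 - 8 * c.re + 16 := by
  rw [Complex.sq_norm, Complex.sq_norm, Complex.normSq_apply, Complex.normSq_apply]
  simp
  ring

/-! ### Types of orientation-preserving isometries -/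

section OrientationPreserving

variable {f : Isom} {A : Matrix (Fin 2) (Fin 2) ℂ}

lemma ActsBy.charpoly_of_nonneg (h : ActsBy f A) (hA : A.det ≠ 0) {x : ℝ} (hx : cInv A = x)
    (hx0 : 0 ≤ x) : (lin f).charpoly = (X - 1) ^ 2 * (X ^ 2 - C (x - 2) * X + 1) := by
  rw [h.charpoly_eq hA, hx, Complex.norm_real, Real.norm_of_nonneg hx0, Complex.ofReal_re]
  have h2 : (C 2 : ℝ[X]) = 2 := map_ofNat C 2
  simp only [C_sub, C_mul, h2]
  ring

lemma ActsBy.charpoly_of_neg (h : ActsBy f A) (hA : A.det ≠ 0) {x : ℝ} (hx : cInv A = x)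
    (hx0 : x < 0) : (lin f).charpoly = (X + 1) ^ 2 * (X ^ 2 - C (2 - x) * X + 1) := by
  rw [h.charpoly_eq hA, hx, Complex.norm_real, Real.norm_of_nonpos hx0.le, Complex.ofReal_re]
  have h2 : (C 2 : ℝ[X]) = 2 := map_ofNat C 2
  simp only [C_sub, C_mul, C_neg, h2]
  ring

lemma ActsBy.loxodromic (h : ActsBy f A) (hA : A.det ≠ 0) (hc : ¬ ∃ x : ℝ, cInv A = x) :
    RotatoryHyperbolic 1 f ∧ ¬ IsStretchHalfTurn f := by
  set c := cInv A with hcdef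
  have him : c.im ≠ 0 := fun h0 => hc ⟨c.re, Complex.ext (by simp) (by simp [h0])⟩
  have hq := norm_sub_four_sq c
  have hcc : ‖c‖ ^ 2 = c.re ^ 2 + c.im ^ 2 := by
    rw [Complex.sq_norm, Complex.normSq_apply]; ring
  have hpos : 0 < c.im ^ 2 := by positivity
  have hcre : |c.re| < ‖c‖ := by
    apply abs_lt_of_sq_lt_sq _ (norm_nonneg _)
    linarith
  have hcre' := abs_lt.1 hcre
  -- `u` and `w` are the distances from `c` to `0` and to `4`. As `c` is not real, the triangle
  -- inequalities are strict: `u + w > 4` and `|u - w| < 4`.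
  set u := ‖c‖ with hu
  set w := ‖c - 4‖ with hw
  have hu0 : 0 ≤ u := norm_nonneg _
  have hw0 : 0 ≤ w := norm_nonneg _
  have hlow : 4 < u + w := by nlinarith
  have hdiff : |u - w| < 4 := by
    rw [abs_lt]
    constructor <;> nlinarith
  have hfac : (lin f).charpoly =
      (X ^ 2 - C (2 * ((u - w) / 4)) * X + 1) * (X ^ 2 - C ((u + w) / 2) * X + 1) := by
    rw [h.charpoly_eq hA, ← hcdef, ← hu]
    -- The middle coefficients `(u ± w) / 2` have sum `u` and product `(u² - w²) / 4 = 2 Re c - 4`.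
    have e1 : (C (2 * ((u - w) / 4)) + C ((u + w) / 2) : ℝ[X]) = C u := by
      rw [← C_add]; congr 1; ring
    have e2 : (C (2 * ((u - w) / 4)) * C ((u + w) / 2) + 2 : ℝ[X]) = C (2 * c.re - 2) := by
      rw [← C_mul, ← map_ofNat C 2, ← C_add]; congr 1; linear_combination -hq / 4
    linear_combination (X ^ 3 + X) * e1 - X ^ 2 * e2
  constructor
  · obtain ⟨r, hr1, hr2, hr⟩ := exists_factor_of_two_lt_abs (y := (u + w) / 2)
      (by rw [abs_of_nonneg (by linarith)]; linarith)
    refine ⟨0, Even.zero, r, 0, {(u - w) / 4}, hr1, hr2, ?_, ?_, rfl⟩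
    · intro a ha
      rw [Multiset.mem_singleton.1 ha, abs_div, abs_of_pos (by norm_num : (0 : ℝ) < 4)]
      linarith
    · rw [hfac, rotPoly_singleton, hr]; ring
  · rintro ⟨-, h2⟩
    have h3 := eval_neg_one_of_hasRotationAngle_pi h2
    have h4 := abs_lt.1 hdiff
    rw [hfac] at h3
    simp only [eval_mul, eval_add, eval_sub, eval_pow, eval_X, eval_C, eval_one] at h3
    rcases mul_eq_zero.1 h3 with h5 | h5 <;> linarith

lemma ActsBy.isStretch (h : ActsBy f A) (hA : A.det ≠ 0) {x : ℝ} (hx : cInv A = x)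
    (h2 : 2 < |x - 2|) (hx0 : 0 < x) : IsStretch f := by
  obtain ⟨r, hr1, hr2, hr⟩ := exists_factor_of_two_lt_abs h2
  refine ⟨0, Even.zero, r, 2, 0, hr1, hr2, by simp, ?_, rfl⟩
  rw [h.charpoly_of_nonneg hA hx hx0.le, rotPoly_zero, hr]; ring

lemma ActsBy.isStretchHalfTurn (h : ActsBy f A) (hA : A.det ≠ 0) {x : ℝ} (hx : cInv A = x)
    (h2 : 2 < |x - 2|) (hx0 : x < 0) : IsStretchHalfTurn f := by
  rw [abs_sub_comm] at h2
  obtain ⟨r, hr1, hr2, hr⟩ := exists_factor_of_two_lt_abs h2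
  have hχ := h.charpoly_of_neg hA hx hx0
  -- A rotation by `π` is recorded by `m = 2` with an empty multiset, so `k = 0 + 2 / 2 = 1`.
  refine ⟨⟨2, even_two, r, 0, 0, hr1, hr2, by simp, ?_, rfl⟩, hasRotationAngle_pi hχ⟩
  rw [hχ, rotPoly_zero, hr]; ring

lemma ActsBy.rotatoryElliptic (h : ActsBy f A) (hA : A.det ≠ 0) {x : ℝ} (hx : cInv A = x)
    (h2 : |x - 2| < 2) : RotatoryElliptic 1 f ∧ ¬ IsHalfTurn f := by
  obtain ⟨h3, h4⟩ := abs_lt.1 h2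
  have hpos : 0 < x := by linarith
  have hχ := h.charpoly_of_nonneg hA hx hpos.le
  obtain ⟨v, hv, hfv⟩ := h.exists_timelike_fixed hA hx hpos.le (by linarith)
  constructor
  · refine ⟨0, Even.zero, ⟨v, hv, 1, by rw [hfv, one_smul]⟩, 2, {(x - 2) / 2}, ?_, ?_, rfl⟩
    · intro a ha
      rw [Multiset.mem_singleton.1 ha, abs_div, abs_of_pos (by norm_num : (0 : ℝ) < 2)]
      linarith
    · rw [hχ, rotPoly_singleton, mul_div_cancel₀ _ two_ne_zero]; ring
  · rintro ⟨-, h5⟩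
    have h6 := eval_neg_one_of_hasRotationAngle_pi h5
    rw [hχ] at h6
    simp only [eval_mul, eval_add, eval_sub, eval_pow, eval_X, eval_C, eval_one] at h6
    linarith

lemma ActsBy.isHalfTurn (h : ActsBy f A) (hA : A.det ≠ 0) (hx : cInv A = (0 : ℝ)) :
    IsHalfTurn f := by
  have hχ : (lin f).charpoly = (X + 1) ^ 2 * (X - 1) ^ 2 := by
    rw [h.charpoly_of_nonneg hA hx le_rfl, zero_sub, C_neg, map_ofNat C 2]
    ring
  obtain ⟨v, hv, hfv⟩ := h.exists_timelike_fixed hA hx le_rfl (by norm_num)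
  refine ⟨⟨2, even_two, ⟨v, hv, 1, by rw [hfv, one_smul]⟩, 2, 0, by simp, ?_, rfl⟩,
    hasRotationAngle_pi hχ⟩
  rw [hχ, rotPoly_zero]; ring

lemma ActsBy.isTranslation (h : ActsBy f A) (hA : A.det ≠ 0) (hx : cInv A = (4 : ℝ))
    (hs : ¬ IsScalar A) : IsTranslation f := by
  have hχ : (lin f).charpoly = (X - 1) ^ 4 := by
    rw [h.charpoly_of_nonneg hA hx (by norm_num), show (4 - 2 : ℝ) = 2 by norm_num, map_ofNat C 2]
    ring
  refine ⟨0, Even.zero, fun hss => hs ?_, 4, 0, by simp, ?_, rfl⟩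
  · have h1 := aeval_eq_zero_of_isSemisimple hss (p := X - 1) (dvd_of_eq hχ)
    refine h.isScalar_of_eq_one hA fun v => ?_
    have h2 := LinearMap.congr_fun h1 v
    simpa [sub_eq_zero] using h2
  · rw [hχ, rotPoly_zero]; ring

end OrientationPreserving

lemma eq_four_of_abs_sub_two {x : ℝ} (hx : x ≠ 0) (h : |x - 2| = 2) : x = 4 := by
  rcases (abs_eq zero_le_two).1 h with h | h
  · linarith
  · exact absurd (by linarith) hx

/-! ### Types of orientation-reversing isometries -/

section OrientationReversing

variable {f : Isom} {A : Matrix (Fin 2) (Fin 2) ℂ}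

lemma ActsByConj.rotatoryEllipticInversion_one (h : ActsByConj f A) (hA : A.det ≠ 0)
    (hτ : |sqTrace A| < 2) : RotatoryEllipticInversion 1 f := by
  have hdB : (A * A.map (starRingEnd ℂ)).det ≠ 0 := by
    rw [det_mul_map_conj]
    exact_mod_cast pow_ne_zero 2 (norm_ne_zero_iff.2 hA)
  have h4 : sqTrace A ^ 2 < 4 := by
    have := abs_lt.1 hτ
    nlinarith
  obtain ⟨v, hv, hv'⟩ := h.mul_self.exists_timelike_fixed hdB (cInv_mul_map_conj hA)
    (sq_nonneg _) h4
  obtain ⟨w, hw, hw'⟩ := exists_timelike_fixed_of_mul_self hv hv'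
  refine ⟨1, odd_one, ⟨w, hw, 1, by rw [hw', one_smul]⟩, 1, {sqTrace A / 2}, ?_, ?_, rfl⟩
  · intro a ha
    rw [Multiset.mem_singleton.1 ha, abs_div, abs_of_pos (by norm_num : (0 : ℝ) < 2)]
    linarith
  · rw [h.charpoly_eq hA, rotPoly_singleton, mul_div_cancel₀ _ two_ne_zero]; ring

lemma ActsByConj.rotatoryHyperbolicInversion_zero (h : ActsByConj f A) (hA : A.det ≠ 0)
    (hτ : 2 < |sqTrace A|) : RotatoryHyperbolicInversion 0 f := by
  obtain ⟨r, hr1, hr2, hr⟩ := exists_factor_of_two_lt_abs hτ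
  refine ⟨1, odd_one, r, 1, 0, hr1, hr2, by simp, ?_, rfl⟩
  rw [h.charpoly_eq hA, rotPoly_zero, hr]; ring

lemma ActsByConj.charpoly_of_two (h : ActsByConj f A) (hA : A.det ≠ 0) (hτ : sqTrace A = 2) :
    (lin f).charpoly = (X - 1) ^ 3 * (X + 1) ^ 1 := by
  rw [h.charpoly_eq hA, hτ, map_ofNat C 2]; ring

lemma ActsByConj.rotatoryParabolicInversion_zero (h : ActsByConj f A) (hA : A.det ≠ 0)
    (hτ : sqTrace A = 2) (hs : ¬ IsScalar (A * A.map (starRingEnd ℂ))) :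
    RotatoryParabolicInversion 0 f := by
  have hdB : (A * A.map (starRingEnd ℂ)).det ≠ 0 := by
    rw [det_mul_map_conj]
    exact_mod_cast pow_ne_zero 2 (norm_ne_zero_iff.2 hA)
  have hχ := h.charpoly_of_two hA hτ
  refine ⟨1, odd_one, fun hss => hs ?_, 3, 0, by simp, ?_, rfl⟩
  -- The eigenvalues are `1` and `-1`, so semisimplicity would give `f² = 1`.
  · have h1 := aeval_eq_zero_of_isSemisimple hss (p := X ^ 2 - 1) (n := 3) ⟨(X + 1) ^ 2, by
      rw [hχ]; ring⟩
    refine h.mul_self.isScalar_of_eq_one hdB fun v => ?_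
    have h2 := LinearMap.congr_fun h1 v
    rw [lin_mul]
    simpa [sub_eq_zero, sq] using h2
  · rw [hχ, rotPoly_zero]

/-- `B = A Ā` is the square of the antilinear map `J : w ↦ A w̄`, and here its only eigenvalue is
`-δ < 0`. If `B` were not scalar, its eigenspace would be a single line, preserved by `J` since `J`
commutes with `B`. On that line `J x = l x`, so `B x = |l|² x`, contradicting the sign. -/
lemma isScalar_of_sqTrace (hA : A.det ≠ 0) (hτ : sqTrace A = -2) :
    IsScalar (A * A.map (starRingEnd ℂ)) := by
  set B := A * A.map (starRingEnd ℂ) with hB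
  have hn : 0 < ‖A.det‖ := norm_pos_iff.2 hA
  have htr : B.trace = -2 * (‖A.det‖ : ℂ) := by
    rw [trace_mul_map_conj_eq_ofReal hA, hτ]; push_cast; rfl
  have hdet : B.det = (‖A.det‖ : ℂ) ^ 2 := by
    rw [det_mul_map_conj]; push_cast; rfl
  set δ := ‖A.det‖
  set N := B + (δ : ℂ) • (1 : Matrix (Fin 2) (Fin 2) ℂ) with hN
  have hNN : N * N = 0 := by
    rw [trace_fin_two] at htr
    rw [det_fin_two] at hdet
    ext i j
    fin_cases i <;> fin_cases j <;> simp [hN, Matrix.mul_apply, Fin.sum_univ_two] <;> grind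
  suffices h0 : N = 0 by
    refine ⟨-(δ : ℂ), ?_⟩
    rw [neg_smul]
    exact eq_neg_of_add_eq_zero_left h0
  by_contra hne
  obtain ⟨j, hj⟩ : ∃ j, N *ᵥ Pi.single j 1 ≠ 0 := by
    by_contra! h
    exact hne (Matrix.ext_of_mulVec_single fun i => by rw [h i, zero_mulVec])
  set x := N *ᵥ Pi.single j 1
  have hNx : N *ᵥ x = 0 := by rw [mulVec_mulVec, hNN, zero_mulVec]
  have hconj : ∀ (M : Matrix (Fin 2) (Fin 2) ℂ) (w : Fin 2 → ℂ),
      M.map (starRingEnd ℂ) *ᵥ w = star (M *ᵥ star w) := fun M w => by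
    ext i
    fin_cases i <;> simp [mulVec, dotProduct, Fin.sum_univ_two]
  set y := A *ᵥ star x with hy
  have hNA : N * A = A * N.map (starRingEnd ℂ) := by
    have h1 : N.map (starRingEnd ℂ) = A.map (starRingEnd ℂ) * A + (δ : ℂ) • 1 := by
      ext i j
      fin_cases i <;> fin_cases j <;> simp [hN, hB, Matrix.mul_apply, Fin.sum_univ_two]
    rw [h1, hN, hB, add_mul, mul_add, mul_assoc, smul_one_mul, mul_smul_one]
  have hNy : N *ᵥ y = 0 := by
    rw [hy, mulVec_mulVec, hNA, ← mulVec_mulVec, hconj, star_star, hNx, star_zero, mulVec_zero]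
  by_cases hxy : x 0 * y 1 - x 1 * y 0 = 0
  · have hlam : ∃ l : ℂ, y = l • x := by
      by_cases hx0 : x 0 = 0
      · have hx1 : x 1 ≠ 0 := fun hx1 => hj (by ext i; fin_cases i <;> simpa)
        refine ⟨y 1 / x 1, ?_⟩
        have hy0 : y 0 = 0 := by simpa [hx0, hx1] using hxy
        ext i; fin_cases i <;> simp [hx0, hy0, hx1]
      · refine ⟨y 0 / x 0, ?_⟩
        ext i; fin_cases i
        · simp [hx0]
        · simp; field_simp; linear_combination hxy
    obtain ⟨l, hl⟩ := hlam
    have h1 : B *ᵥ x = (conj l * l) • x := by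
      rw [hB, ← mulVec_mulVec, hconj, ← hy, hl, star_smul, mulVec_smul, ← hy, hl, smul_smul]
      rfl
    have h2 : B *ᵥ x = (-(δ : ℂ)) • x := by
      rw [hN, add_mulVec, smul_mulVec, one_mulVec] at hNx
      rw [neg_smul]
      exact eq_neg_of_add_eq_zero_left hNx
    rw [h1] at h2
    have h3 := smul_left_injective ℂ hj h2
    have h4 : ((‖l‖ ^ 2 : ℝ) : ℂ) = ((-δ : ℝ) : ℂ) := by
      push_cast
      rw [← h3]
      exact (Complex.conj_mul' l).symm
    have h5 := Complex.ofReal_injective h4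
    have := sq_nonneg ‖l‖
    linarith
  -- Here `x` and `y` are independent vectors killed by `N`, so `N = 0`.
  · apply hne
    ext i j
    have e1 := congrFun hNx i
    have e2 := congrFun hNy i
    simp only [mulVec, dotProduct, Fin.sum_univ_two, Pi.zero_apply] at e1 e2
    apply mul_right_cancel₀ hxy
    rw [Matrix.zero_apply, zero_mul]
    fin_cases j
    · change N i 0 * _ = 0
      linear_combination y 1 * e1 - x 1 * e2
    · change N i 1 * _ = 0
      linear_combination x 0 * e2 - y 0 * e1

lemma ActsByConj.mul_self_eq_one (h : ActsByConj f A) (hA : A.det ≠ 0)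
    (hs : IsScalar (A * A.map (starRingEnd ℂ))) : f * f = 1 := by
  have hdB : (A * A.map (starRingEnd ℂ)).det ≠ 0 := by
    rw [det_mul_map_conj]
    exact_mod_cast pow_ne_zero 2 (norm_ne_zero_iff.2 hA)
  exact eq_one_of_lin_eq_self (h.mul_self.lin_eq_self_of_isScalar hdB hs)

end OrientationReversing

/-! ### Involutions, boundary fixed points and antipodal maps -/

lemma exists_timelike_fixed_of_involution {f : Isom} (h : f * f = 1) :
    ∃ w, 0 < Q w ∧ lin f w = w := by
  have h1 : lin f (lin f ![1, 0, 0, 0]) = ![1, 0, 0, 0] := by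
    rw [← lin_mul, h]; rfl
  exact exists_timelike_fixed_of_mul_self (by simp [Q]) h1

lemma ActsByConj.rotatoryEllipticInversion_zero {f : Isom} {A : Matrix (Fin 2) (Fin 2) ℂ}
    (h : ActsByConj f A) (hA : A.det ≠ 0)
    (hs : IsScalar (A * A.map (starRingEnd ℂ))) (hτ : sqTrace A = 2) :
    RotatoryEllipticInversion 0 f := by
  obtain ⟨w, hw, hw'⟩ := exists_timelike_fixed_of_involution (h.mul_self_eq_one hA hs)
  refine ⟨1, odd_one, ⟨w, hw, 1, by rw [hw', one_smul]⟩, 3, 0, by simp, ?_, rfl⟩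
  rw [h.charpoly_of_two hA hτ, rotPoly_zero]

lemma exists_eq_smul_light {n : V} (hQ : Q n = 0) (h0 : n 0 ≠ 0) :
    ∃ (t : ℝ) (p : OnePoint ℂ), t ≠ 0 ∧ n = t • light p := by
  simp only [Q] at hQ
  by_cases h3 : n 3 = n 0
  · have h12 : n 1 ^ 2 + n 2 ^ 2 = 0 := by rw [h3] at hQ; linarith
    have h1 : n 1 = 0 := by nlinarith [sq_nonneg (n 1), sq_nonneg (n 2)]
    have h2 : n 2 = 0 := by nlinarith [sq_nonneg (n 1), sq_nonneg (n 2)]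
    refine ⟨n 0, OnePoint.infty, h0, ?_⟩
    ext i; fin_cases i <;> simp [light_infty, h1, h2, h3]
  · have hd : n 0 - n 3 ≠ 0 := fun h => h3 (by linarith)
    refine ⟨(n 0 - n 3) / 2, ((⟨n 1 / (n 0 - n 3), n 2 / (n 0 - n 3)⟩ : ℂ) : OnePoint ℂ),
      div_ne_zero hd two_ne_zero, ?_⟩
    ext i; fin_cases i <;> simp [light_coe, Complex.normSq_apply] <;> field_simp <;> linarith

lemma eq_of_smul_light_eq {s t : ℝ} (hs : 0 < s) {p q : OnePoint ℂ}
    (h : s • light p = t • light q) : p = q := by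
  have h0 := congrFun h 0
  have h1 := congrFun h 1
  have h2 := congrFun h 2
  have h3 := congrFun h 3
  induction p using OnePoint.rec with
  | infty =>
    induction q using OnePoint.rec with
    | infty => rfl
    | coe z =>
      simp [light_infty, light_coe] at h0 h1 h2 h3
      exfalso
      nlinarith [Complex.normSq_nonneg z]
  | coe w =>
    induction q using OnePoint.rec with
    | infty =>
      simp [light_infty, light_coe] at h0 h1 h2 h3
      exfalso
      nlinarith [Complex.normSq_nonneg w]
    | coe z =>
      simp [light_coe] at h0 h1 h2 h3
      have hst : s = t := by linarith
      subst hst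
      congr 1
      apply Complex.ext
      · simpa [hs.ne'] using h1
      · simpa [hs.ne'] using h2

lemma boundaryMap_unique {f : Isom} {φ ψ : OnePoint ℂ → OnePoint ℂ} (hφ : BoundaryMap f φ)
    (hψ : BoundaryMap f ψ) (p : OnePoint ℂ) : φ p = ψ p := by
  obtain ⟨s, hs, h1⟩ := hφ p
  obtain ⟨t, -, h2⟩ := hψ p
  exact eq_of_smul_light_eq hs (h1.symm.trans h2)

/-- `T + 1` has rank at most one and trace `l p`. -/
lemma charpoly_neg_add_rankOne {T : V →ₗ[ℝ] V} {l : V →ₗ[ℝ] ℝ} {p : V}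
    (h : ∀ v, T v = -v + l v • p) : T.charpoly = (X + 1) ^ 3 * (X + 1 - C (l p)) := by
  have h1 : LinearMap.toMatrix' T = !![
      p 0 * l (Pi.single 0 1) - 1, p 0 * l (Pi.single 1 1), p 0 * l (Pi.single 2 1),
        p 0 * l (Pi.single 3 1);
      p 1 * l (Pi.single 0 1), p 1 * l (Pi.single 1 1) - 1, p 1 * l (Pi.single 2 1),
        p 1 * l (Pi.single 3 1);
      p 2 * l (Pi.single 0 1), p 2 * l (Pi.single 1 1), p 2 * l (Pi.single 2 1) - 1,
        p 2 * l (Pi.single 3 1);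
      p 3 * l (Pi.single 0 1), p 3 * l (Pi.single 1 1), p 3 * l (Pi.single 2 1),
        p 3 * l (Pi.single 3 1) - 1] := by
    ext i j
    rw [LinearMap.toMatrix'_apply, h]
    fin_cases i <;> fin_cases j <;> simp <;> ring
  have h2 : l p = p 0 * l (Pi.single 0 1) + p 1 * l (Pi.single 1 1) + p 2 * l (Pi.single 2 1) +
      p 3 * l (Pi.single 3 1) := by
    conv_lhs => rw [LinearMap.pi_apply_eq_sum_univ l p]
    simp only [Fin.sum_univ_four, smul_eq_mul]
    congr! <;> simp [Pi.single_apply, eq_comm]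
  have h4 : T.charpoly = (LinearMap.toMatrix' T).charpoly := by
    rw [← Matrix.charpoly_toLin', Matrix.toLin'_toMatrix']
  rw [h4, h1, h2, Matrix.charpoly, Matrix.charmatrix, Matrix.det_succ_row_zero]
  simp [Fin.sum_univ_succ, Matrix.det_succ_row_zero, Fin.succAbove, Matrix.submatrix]
  ring

/-- No inducing matrix is given here, so the argument is geometric: with no light-like fixed ray,
the fixed space is the line of one time-like vector `p`, and the involution `f` is `-1` modulo that
line. -/
lemma IsAntipodal.rotatoryEllipticInversion_one {f : Isom} (h : IsAntipodal f) :
    RotatoryEllipticInversion 1 f := by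
  obtain ⟨-, ho, φ, hφ, hfix⟩ := h
  have hff : f * f = 1 := by rw [← sq, ← ho, pow_orderOf_eq_one]
  have hff' : ∀ v, lin f (lin f v) = v := fun v => by rw [← lin_mul, hff]; rfl
  obtain ⟨p, hp, hfp⟩ := exists_timelike_fixed_of_involution hff
  have hp0 : p 0 ≠ 0 := by
    intro h1
    simp only [Q, h1] at hp
    nlinarith [sq_nonneg (p 1), sq_nonneg (p 2), sq_nonneg (p 3)]
  have key : ∀ q, lin f q = q → q 0 = 0 → q = 0 := by
    intro q hq hq0
    by_contra hne
    have hQq : Q q < 0 := by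
      have h5 : 0 < q 1 ^ 2 + q 2 ^ 2 + q 3 ^ 2 := by
        by_contra! h5
        apply hne
        ext i
        fin_cases i
        · exact hq0
        all_goals
          simp
          nlinarith [sq_nonneg (q 1), sq_nonneg (q 2), sq_nonneg (q 3)]
      simp only [Q, hq0]
      linarith
    -- `Q (p + s q)` is quadratic in `s`, with leading coefficient negative and constant term
    -- positive. At a real root, `p + s q` is a light-like fixed vector.
    obtain ⟨s, hs⟩ : ∃ s : ℝ, Q q * (s * s) +
        (2 * (p 0 * q 0 - p 1 * q 1 - p 2 * q 2 - p 3 * q 3)) * s + Q p = 0 := by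
      apply exists_quadratic_eq_zero hQq.ne
      refine ⟨Real.sqrt _, (Real.mul_self_sqrt ?_).symm⟩
      rw [discrim]
      nlinarith [sq_nonneg (2 * (p 0 * q 0 - p 1 * q 1 - p 2 * q 2 - p 3 * q 3))]
    have hn : Q (p + s • q) = 0 := by
      rw [← hs]
      simp only [Q, Pi.add_apply, Pi.smul_apply, smul_eq_mul]
      ring
    have hfn : lin f (p + s • q) = p + s • q := by rw [map_add, map_smul, hfp, hq]
    obtain ⟨t, z, ht, hz⟩ := exists_eq_smul_light hn (by simpa [hq0] using hp0)
    rw [hz, map_smul] at hfn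
    have h6 := smul_right_injective V ht hfn
    obtain ⟨r, hr, h7⟩ := hφ z
    exact hfix z (eq_of_smul_light_eq hr (t := 1) (by rw [← h7, h6, one_smul]))
  -- Chosen so that the fixed vector `f v + v - l(v) p` has zero time coordinate; by `key` it
  -- vanishes.
  let l : V →ₗ[ℝ] ℝ := (p 0)⁻¹ • (LinearMap.proj 0 ∘ₗ (lin f + LinearMap.id))
  have hl : ∀ v, l v = (p 0)⁻¹ * (lin f v 0 + v 0) := fun v => rfl
  have hlin : ∀ v, lin f v = -v + l v • p := by
    intro v
    have h8 := key (lin f v + v - l v • p) (by rw [map_sub, map_add, map_smul, hff', hfp]; abel)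
      (by
        simp only [Pi.sub_apply, Pi.add_apply, Pi.smul_apply, smul_eq_mul, hl]
        field_simp
        ring)
    rw [sub_eq_zero] at h8
    rw [← h8]
    abel
  have hlp : l p = 2 := by
    rw [hl, hfp]
    field_simp
    ring
  -- The eigenvalue `-1` has multiplicity `m = 3`, and `k = 3 / 2` rounds down to `1`.
  refine ⟨3, by decide, ⟨p, hp, 1, by rw [hfp, one_smul]⟩, 1, 0, by simp, ?_, rfl⟩
  rw [charpoly_neg_add_rankOne hlin, hlp, rotPoly_zero, map_ofNat C 2]
  ring

/-! ### Normalized matrices -/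

/-- The equation form turns normalization into a condition on scalars, because `adj` is linear on `2
× 2` matrices. -/
lemma isNormalized_iff {M : Matrix (Fin 2) (Fin 2) ℂ} :
    IsNormalized M ↔ M.map (starRingEnd ℂ) = -M.adjugate := by
  rw [adjugate_fin_two]
  constructor
  · rintro ⟨a, b, c, rfl⟩
    ext i j
    fin_cases i <;> fin_cases j <;> simp
  · intro h
    have h00 := congrFun (congrFun h 0) 0
    have h01 := congrFun (congrFun h 0) 1
    have h10 := congrFun (congrFun h 1) 0
    simp at h00 h01 h10
    obtain ⟨b, hb⟩ := Complex.conj_eq_iff_real.1 h01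
    obtain ⟨c, hc⟩ := Complex.conj_eq_iff_real.1 h10
    refine ⟨M 0 0, b, c, ?_⟩
    ext i j
    fin_cases i <;> fin_cases j <;> simp [hb, hc, h00]

lemma IsNormalized.mul_map_conj {M : Matrix (Fin 2) (Fin 2) ℂ} (h : IsNormalized M) :
    M * M.map (starRingEnd ℂ) = (-M.det) • (1 : Matrix (Fin 2) (Fin 2) ℂ) := by
  rw [isNormalized_iff.1 h, mul_neg, mul_adjugate, neg_smul]

lemma IsNormalized.det_real {M : Matrix (Fin 2) (Fin 2) ℂ} (h : IsNormalized M) :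
    ∃ δ : ℝ, M.det = δ := by
  obtain ⟨a, b, c, rfl⟩ := h
  refine ⟨-Complex.normSq a - b * c, ?_⟩
  rw [det_fin_two_of]
  push_cast
  rw [Complex.normSq_eq_conj_mul_self]
  ring

lemma IsNormalized.isScalar {M : Matrix (Fin 2) (Fin 2) ℂ} (h : IsNormalized M) :
    IsScalar (M * M.map (starRingEnd ℂ)) := ⟨_, h.mul_map_conj⟩

lemma IsNormalized.sqTrace_of_neg {M : Matrix (Fin 2) (Fin 2) ℂ} (h : IsNormalized M) {δ : ℝ}
    (hδ : M.det = δ) (h0 : δ < 0) : sqTrace M = 2 := by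
  rw [sqTrace, h.mul_map_conj, hδ, Complex.norm_real, Real.norm_of_nonpos h0.le, trace_smul,
    trace_one, Fintype.card_fin]
  have : (-(δ : ℂ) • ((2 : ℕ) : ℂ)).re = -δ * 2 := by simp
  rw [this, mul_div_cancel_left₀ _ (neg_ne_zero.2 h0.ne)]

lemma exists_normalizing_scalar {A : Matrix (Fin 2) (Fin 2) ℂ} (hA : A.det ≠ 0)
    (hs : IsScalar (A * A.map (starRingEnd ℂ))) :
    ∃ u : ℂ, u ≠ 0 ∧ IsNormalized (u • A) ∧
      ∀ v : ℂ, (v ≠ 0 ∧ IsNormalized (v • A)) ↔ ∃ t : ℝ, t ≠ 0 ∧ v = t * u := by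
  obtain ⟨β, hβ⟩ := hs
  set ω := β / A.det with hω
  -- Multiply `A Ā = β` on the left by `adj A`. Comparing determinants then gives `|β| = |det A|`,
  -- so `ω` is unimodular.
  have hmap : A.map (starRingEnd ℂ) = ω • A.adjugate := by
    have h1 := congrArg (A.adjugate * ·) hβ
    simp only [← mul_assoc, adjugate_mul, smul_one_mul, mul_smul_one] at h1
    rw [hω, div_eq_inv_mul, mul_smul, ← h1, smul_smul, inv_mul_cancel₀ hA, one_smul]
  have hω1 : ‖ω‖ = 1 := by
    have h1 := congrArg (fun M => ‖det M‖) hβ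
    simp only [det_mul_map_conj, det_smul, det_one, Fintype.card_fin, mul_one, norm_pow,
      Complex.norm_real, norm_norm, Complex.ofReal_pow] at h1
    have h2 : ‖β‖ = ‖A.det‖ :=
      ((pow_left_inj₀ (norm_nonneg _) (norm_nonneg _) two_ne_zero).1 h1).symm
    rw [hω, norm_div, h2, div_self (norm_ne_zero_iff.2 hA)]
  have hω0 : ω ≠ 0 := fun h => by simp [h] at hω1
  have hadj : A.adjugate ≠ 0 := fun h => by
    have h1 := mul_adjugate A
    rw [h, mul_zero] at h1
    exact hA (by simpa using (congrFun (congrFun h1 0) 0).symm)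
  have hiff : ∀ v : ℂ, IsNormalized (v • A) ↔ conj v * ω = -v := fun v => by
    have h1 : (v • A).map (starRingEnd ℂ) = (conj v * ω) • A.adjugate := by
      rw [mul_smul, ← hmap]
      ext i j
      simp
    rw [isNormalized_iff, h1, adjugate_smul, Fintype.card_fin, ← neg_smul, pow_one]
    exact (smul_left_injective ℂ hadj).eq_iff
  -- On the unit circle the condition `ū ω = -u` reads `u² = -ω`. Two non-zero solutions have a real
  -- quotient.
  obtain ⟨u, hu⟩ := IsAlgClosed.exists_pow_nat_eq (-ω) (n := 2) two_pos
  have hu1 : ‖u‖ = 1 := by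
    have h1 := congrArg norm hu
    rw [norm_pow, norm_neg, hω1] at h1
    exact (pow_eq_one_iff_of_nonneg (norm_nonneg _) two_ne_zero).1 h1
  have hu0 : u ≠ 0 := fun h => by simp [h] at hu1
  have hcu : conj u * u = 1 := by rw [Complex.conj_mul', hu1]; simp
  have hnu : conj u * ω = -u := by linear_combination conj u * hu - u * hcu
  refine ⟨u, hu0, (hiff u).2 hnu, fun v => ?_⟩
  rw [hiff]
  constructor
  · rintro ⟨hv0, hv⟩
    have hcu0 : conj u ≠ 0 := by simpa using hu0
    have h1 : conj (v / u) = v / u := by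
      rw [map_div₀, div_eq_div_iff hcu0 hu0]
      apply mul_right_cancel₀ hω0
      linear_combination u * hv - v * hnu
    obtain ⟨t, ht⟩ := Complex.conj_eq_iff_real.1 h1
    refine ⟨t, ?_, ?_⟩
    · rintro rfl
      rw [Complex.ofReal_zero, div_eq_zero_iff] at ht
      tauto
    · rw [← ht, div_mul_cancel₀ _ hu0]
  · rintro ⟨t, ht, rfl⟩
    refine ⟨mul_ne_zero (by exact_mod_cast ht) hu0, ?_⟩
    rw [map_mul, Complex.conj_ofReal]
    linear_combination (t : ℂ) * hnu

lemma smul_eq_smul_of_eq_smul {A M : GL (Fin 2) ℂ} {u : ℂ} (hu : u ≠ 0)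
    (h : (M : Matrix (Fin 2) (Fin 2) ℂ) = u • (A : Matrix (Fin 2) (Fin 2) ℂ)) (p : OnePoint ℂ) :
    M • p = A • p := by
  have e : ∀ i j, M i j = u * A i j := fun i j => congrFun (congrFun h i) j
  induction p using OnePoint.rec with
  | infty =>
    rw [OnePoint.smul_infty_eq_ite, OnePoint.smul_infty_eq_ite, e, e]
    simp only [mul_eq_zero, hu, false_or, mul_div_mul_left _ _ hu]
  | coe z =>
    rw [OnePoint.smul_some_eq_ite, OnePoint.smul_some_eq_ite, e, e, e, e]
    simp only [mul_assoc, ← mul_add, mul_eq_zero, hu, false_or, mul_div_mul_left _ _ hu]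

/-! ### Circle inversions and normalized matrices of negative determinant -/

lemma conjHat_infty : conjHat OnePoint.infty = OnePoint.infty := rfl

lemma conjHat_coe (z : ℂ) : conjHat (z : OnePoint ℂ) = ((conj z : ℂ) : OnePoint ℂ) := rfl

lemma inversion_eq {w z : ℂ} (R : ℝ) (hz : z ≠ w) :
    EuclideanGeometry.inversion w R z = w + R ^ 2 / conj (z - w) := by
  have h1 : z - w ≠ 0 := sub_ne_zero.2 hz
  have h2 : conj (z - w) ≠ 0 := (_root_.map_ne_zero _).2 h1
  have h3 : (‖z - w‖ : ℂ) ^ 2 = (z - w) * conj (z - w) := (Complex.mul_conj' _).symm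
  rw [EuclideanGeometry.inversion, vsub_eq_sub, vadd_eq_add, dist_eq_norm, Complex.real_smul]
  push_cast
  rw [div_pow, h3, add_comm]
  congr 1
  field_simp

lemma isInversionMap_of_isNormalized {M : GL (Fin 2) ℂ}
    (h : IsNormalized (M : Matrix (Fin 2) (Fin 2) ℂ)) {δ : ℝ}
    (hδ : (M : Matrix (Fin 2) (Fin 2) ℂ).det = δ) (h0 : δ < 0) :
    IsInversionMap (fun z => M • conjHat z) := by
  obtain ⟨a, b, c, hM⟩ := h
  have e00 : M 0 0 = a := by rw [hM]; rfl
  have e01 : M 0 1 = b := by rw [hM]; rfl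
  have e10 : M 1 0 = c := by rw [hM]; rfl
  have e11 : M 1 1 = -conj a := by rw [hM]; rfl
  have hd : Complex.normSq a + b * c = -δ := by
    rw [hM, det_fin_two_of] at hδ
    apply Complex.ofReal_injective
    push_cast
    rw [Complex.normSq_eq_conj_mul_self]
    linear_combination -hδ
  by_cases hc : c = 0
  · right
    subst hc
    have ha : a ≠ 0 := fun h => by
      rw [h] at hd
      simp at hd
      linarith
    have hca : conj a ≠ 0 := (_root_.map_ne_zero _).2 ha
    obtain ⟨e, he⟩ := IsAlgClosed.exists_pow_nat_eq (-a / conj a) (n := 2) two_pos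
    -- The base point is the midpoint of `0` and its image `-b / ā`, hence lies on the mirror line.
    refine ⟨-b / (2 * conj a), e, ?_, ?_, fun z => ?_⟩
    · have h1 := congrArg norm he
      rw [norm_pow, norm_div, norm_neg, Complex.norm_conj, div_self (norm_ne_zero_iff.2 ha)] at h1
      exact (pow_eq_one_iff_of_nonneg (norm_nonneg _) two_ne_zero).1 h1
    · simp only [conjHat_infty, OnePoint.smul_infty_eq_ite, e10, Complex.ofReal_zero, if_true]
    · simp only [conjHat_coe, OnePoint.smul_some_eq_ite, e00, e01, e10, e11, Complex.ofReal_zero,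
        zero_mul, zero_add, neg_eq_zero, hca, if_false, he]
      congr 1
      simp only [map_sub, map_div₀, map_neg, map_mul, Complex.conj_conj, Complex.conj_ofReal,
        map_ofNat]
      field_simp
      ring
  · left
    have hc' : (c : ℂ) ≠ 0 := by exact_mod_cast hc
    -- The centre is the image of `∞`; the fixed-point equation is `|c z - a|² = -δ`, which gives
    -- the radius.
    refine ⟨a / c, Real.sqrt (-δ) / |c|,
      div_pos (Real.sqrt_pos.2 (neg_pos.2 h0)) (abs_pos.2 hc), ?_, ?_, fun z hz => ?_⟩
    · simp only [conjHat_infty, OnePoint.smul_infty_eq_ite, e00, e10, hc', if_false]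
    · simp only [conjHat_coe, OnePoint.smul_some_eq_ite, e10, e11, map_div₀, Complex.conj_ofReal]
      rw [if_pos]
      field_simp
      ring
    · have hz' : z - a / c ≠ 0 := sub_ne_zero.2 hz
      have hz1 : conj (z - a / c) ≠ 0 := (_root_.map_ne_zero _).2 hz'
      have hden : c * conj z + -conj a = c * conj (z - a / c) := by
        rw [map_sub, map_div₀, Complex.conj_ofReal]; field_simp; ring
      have hden0 : c * conj z + -conj a ≠ 0 := by rw [hden]; exact mul_ne_zero hc' hz1
      have hR : ((Real.sqrt (-δ) / |c| : ℝ) : ℂ) ^ 2 = (a * conj a + b * c) / c ^ 2 := by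
        rw [← Complex.ofReal_pow, div_pow, Real.sq_sqrt (by linarith), sq_abs, ← hd]
        push_cast
        rw [Complex.normSq_eq_conj_mul_self, mul_comm a]
      simp only [conjHat_coe, OnePoint.smul_some_eq_ite, e00, e01, e10, e11, hden0, if_false]
      rw [inversion_eq _ hz, hR, hden]
      congr 1
      have hcz : conj z = conj (z - a / c) + conj a / c := by
        rw [map_sub, map_div₀, Complex.conj_ofReal]; ring
      rw [hcz]
      generalize conj (z - a / c) = q at hz1
      field_simp
      ring

lemma exists_isNormalized_of_isInversionMap {φ : OnePoint ℂ → OnePoint ℂ}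
    (h : IsInversionMap φ) : ∃ (M : GL (Fin 2) ℂ) (δ : ℝ),
      IsNormalized (M : Matrix (Fin 2) (Fin 2) ℂ) ∧
      (M : Matrix (Fin 2) (Fin 2) ℂ).det = δ ∧ δ < 0 ∧ ∀ p, φ p = M • conjHat p := by
  rcases h with ⟨w, R, hR, h1, h2, h3⟩ | ⟨w, e, he, h1, h2⟩
  · let N : Matrix (Fin 2) (Fin 2) ℂ :=
      !![w, ((R ^ 2 - Complex.normSq w : ℝ) : ℂ); ((1 : ℝ) : ℂ), -conj w]
    have hN : N.det = ((-R ^ 2 : ℝ) : ℂ) := by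
      rw [det_fin_two_of]
      push_cast
      rw [Complex.normSq_eq_conj_mul_self]
      ring
    have hN0 : N.det ≠ 0 := by
      rw [hN]
      exact_mod_cast (neg_lt_zero.2 (by positivity : 0 < R ^ 2)).ne
    let M : GL (Fin 2) ℂ := GeneralLinearGroup.mkOfDetNeZero N hN0
    have e00 : M 0 0 = w := rfl
    have e01 : M 0 1 = ((R ^ 2 - Complex.normSq w : ℝ) : ℂ) := rfl
    have e10 : M 1 0 = 1 := Complex.ofReal_one
    have e11 : M 1 1 = -conj w := rfl
    refine ⟨M, -R ^ 2, ⟨w, _, 1, rfl⟩, hN, neg_lt_zero.2 (by positivity), fun p => ?_⟩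
    induction p using OnePoint.rec with
    | infty =>
      rw [h1, conjHat_infty, OnePoint.smul_infty_eq_ite, e00, e10, if_neg one_ne_zero, div_one]
    | coe z =>
      rw [conjHat_coe, OnePoint.smul_some_eq_ite, e00, e01, e10, e11, one_mul, ← sub_eq_add_neg,
        ← map_sub]
      by_cases hz : z = w
      · rw [hz, h2, sub_self, map_zero, if_pos rfl]
      · have hz1 : conj (z - w) ≠ 0 := (_root_.map_ne_zero _).2 (sub_ne_zero.2 hz)
        rw [h3 z hz, if_neg hz1, inversion_eq _ hz]
        congr 1
        push_cast
        rw [Complex.normSq_eq_conj_mul_self]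
        field_simp
        rw [map_sub]
        ring
  -- The reflection is a fraction with denominator `1`; expanding by `i ē`, where `ē e = 1`, gives
  -- this normalized matrix. The factor `i` yields the relation `d = -ā`.
  · let N : Matrix (Fin 2) (Fin 2) ℂ :=
      !![Complex.I * e, ((-2 * (conj e * w).im : ℝ) : ℂ); ((0 : ℝ) : ℂ), -conj (Complex.I * e)]
    have hee : conj e * e = 1 := by rw [Complex.conj_mul', he]; simp
    have he0 : e ≠ 0 := fun h => by simp [h] at he
    have hce : conj e ≠ 0 := (_root_.map_ne_zero _).2 he0
    have hN : N.det = ((-1 : ℝ) : ℂ) := by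
      rw [det_fin_two_of, map_mul, Complex.conj_I]
      push_cast
      linear_combination (Complex.I ^ 2) * hee + Complex.I_sq
    have hN0 : N.det ≠ 0 := by rw [hN]; norm_num
    let M : GL (Fin 2) ℂ := GeneralLinearGroup.mkOfDetNeZero N hN0
    have e00 : M 0 0 = Complex.I * e := rfl
    have e01 : M 0 1 = Complex.I * (conj e * w - e * conj w) := by
      have h3 := Complex.sub_conj (conj e * w)
      rw [map_mul, Complex.conj_conj] at h3
      change ((-2 * (conj e * w).im : ℝ) : ℂ) = _
      rw [h3]
      push_cast
      linear_combination (-2 * ((conj e * w).im : ℂ)) * Complex.I_sq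
    have e10 : M 1 0 = 0 := Complex.ofReal_zero
    have e11 : M 1 1 = Complex.I * conj e := by
      change -conj (Complex.I * e) = _
      rw [map_mul, Complex.conj_I]
      ring
    refine ⟨M, -1, ⟨_, _, 0, rfl⟩, hN, by norm_num, fun p => ?_⟩
    induction p using OnePoint.rec with
    | infty =>
      rw [h1, conjHat_infty, OnePoint.smul_infty_eq_ite, e10, if_pos rfl]
    | coe z =>
      rw [h2, conjHat_coe, OnePoint.smul_some_eq_ite, e00, e01, e10, e11, zero_mul, zero_add,
        if_neg (mul_ne_zero Complex.I_ne_zero hce)]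
      congr 1
      rw [mul_assoc, ← mul_add, mul_div_mul_left _ _ Complex.I_ne_zero, map_sub, eq_div_iff hce]
      linear_combination (e * conj z - e * conj w) * hee

lemma IsCircleInversion.rotatoryEllipticInversion_zero {f : Isom} (h : IsCircleInversion f) :
    RotatoryEllipticInversion 0 f := by
  obtain ⟨φ, hφ, h1⟩ := h
  obtain ⟨M, δ, hM, hδ, h0, h2⟩ := exists_isNormalized_of_isInversionMap h1
  have hb : BoundaryMap f (fun z => M • conjHat z) := by
    rwa [show (fun z => M • conjHat z) = φ from (funext h2).symm]
  exact (actsByConj_of_boundaryMap hb).rotatoryEllipticInversion_zero M.det_ne_zero hM.isScalar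
    (hM.sqTrace_of_neg hδ h0)

lemma IsInversionMap.exists_fixed {φ : OnePoint ℂ → OnePoint ℂ} (h : IsInversionMap φ) :
    ∃ p, φ p = p := by
  rcases h with ⟨w, R, hR, -, -, h3⟩ | ⟨w, e, -, -, h2⟩
  · refine ⟨((w + R : ℂ) : OnePoint ℂ), ?_⟩
    rw [h3 _ (by simpa using hR.ne'), EuclideanGeometry.inversion_of_mem_sphere]
    simp [hR.le]
  · refine ⟨(w : OnePoint ℂ), ?_⟩
    rw [h2, sub_self, map_zero, mul_zero, add_zero]

lemma IsCircleInversion.not_isAntipodal {f : Isom} (h : IsCircleInversion f) :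
    ¬ IsAntipodal f := by
  rintro ⟨-, -, ψ, hψ, h3⟩
  obtain ⟨φ, hφ, h1⟩ := h
  obtain ⟨p, hp⟩ := h1.exists_fixed
  exact h3 p ((boundaryMap_unique hψ hφ p).trans hp)

/-! ### Positive determinant, and the dichotomy -/

lemma smul_conjHat_ne_of_isNormalized {M : GL (Fin 2) ℂ}
    (h : IsNormalized (M : Matrix (Fin 2) (Fin 2) ℂ)) {δ : ℝ}
    (hδ : (M : Matrix (Fin 2) (Fin 2) ℂ).det = δ) (h0 : 0 < δ) (p : OnePoint ℂ) :
    M • conjHat p ≠ p := by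
  obtain ⟨a, b, c, hM⟩ := h
  have e00 : M 0 0 = a := by rw [hM]; rfl
  have e01 : M 0 1 = b := by rw [hM]; rfl
  have e10 : M 1 0 = c := by rw [hM]; rfl
  have e11 : M 1 1 = -conj a := by rw [hM]; rfl
  have hd : Complex.normSq a + b * c = -δ := by
    rw [hM, det_fin_two_of] at hδ
    apply Complex.ofReal_injective
    push_cast
    rw [Complex.normSq_eq_conj_mul_self]
    linear_combination -hδ
  have hc : (c : ℂ) ≠ 0 := by
    intro hc
    have hc0 : c = 0 := by exact_mod_cast hc
    rw [hc0] at hd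
    linarith [Complex.normSq_nonneg a]
  induction p using OnePoint.rec with
  | infty =>
    rw [conjHat_infty, OnePoint.smul_infty_eq_ite, e10, if_neg hc]
    exact OnePoint.coe_ne_infty _
  | coe z =>
    rw [conjHat_coe, OnePoint.smul_some_eq_ite, e00, e01, e10, e11]
    split_ifs with h1
    · exact OnePoint.infty_ne_coe _
    · intro h2
      have h3 := OnePoint.coe_injective h2
      rw [div_eq_iff h1] at h3
      -- The equation of the fixed circle, now with a negative right-hand side.
      have h4 : Complex.normSq (c * z - a) = -δ := by
        rw [← hd]
        apply Complex.ofReal_injective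
        push_cast
        rw [Complex.normSq_eq_conj_mul_self, Complex.normSq_eq_conj_mul_self]
        simp only [map_sub, map_mul, Complex.conj_ofReal]
        linear_combination -(c : ℂ) * h3
      linarith [Complex.normSq_nonneg (c * z - a)]

lemma isAntipodal_of_isNormalized {f : Isom} {M : GL (Fin 2) ℂ}
    (hf : OrientationReversing f) (hb : BoundaryMap f (fun z => M • conjHat z))
    (h : IsNormalized (M : Matrix (Fin 2) (Fin 2) ℂ)) {δ : ℝ}
    (hδ : (M : Matrix (Fin 2) (Fin 2) ℂ).det = δ) (h0 : 0 < δ) : IsAntipodal f := by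
  refine ⟨hf, orderOf_eq_prime ?_ ?_, _, hb, smul_conjHat_ne_of_isNormalized h hδ h0⟩
  · rw [sq]
    exact (actsByConj_of_boundaryMap hb).mul_self_eq_one M.det_ne_zero h.isScalar
  · rintro rfl
    have h1 : lin 1 = LinearMap.id := rfl
    rw [OrientationReversing, h1, LinearMap.det_id] at hf
    linarith

lemma InducedBy.boundaryMap_of_preserving {f : Isom} {A : GL (Fin 2) ℂ} (h : InducedBy f A)
    (hf : OrientationPreserving f) : BoundaryMap f (fun z => A • z) := by
  rcases h with ⟨-, h⟩ | ⟨h1, -⟩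
  · exact h
  · exact absurd hf (not_lt.2 (le_of_lt h1))

lemma InducedBy.boundaryMap_of_reversing {f : Isom} {A : GL (Fin 2) ℂ} (h : InducedBy f A)
    (hf : OrientationReversing f) : BoundaryMap f (fun z => A • conjHat z) := by
  rcases h with ⟨h1, -⟩ | ⟨-, h⟩
  · exact absurd hf (not_lt.2 (le_of_lt h1))
  · exact h

lemma isCircleInversion_or_isAntipodal {f : Isom} {A : GL (Fin 2) ℂ}
    (hf : OrientationReversing f) (hb : BoundaryMap f (fun z => A • conjHat z)) {u : ℂ}
    (hu : u ≠ 0) (h : IsNormalized (u • (A : Matrix (Fin 2) (Fin 2) ℂ))) :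
    (IsCircleInversion f ∨ IsAntipodal f) ∧
    ∃ δ : ℝ, (u • (A : Matrix (Fin 2) (Fin 2) ℂ)).det = δ ∧ δ ≠ 0 ∧
      (δ < 0 ↔ IsCircleInversion f) ∧ (0 < δ ↔ IsAntipodal f) := by
  obtain ⟨δ, hδ⟩ := h.det_real
  have hM0 : (u • (A : Matrix (Fin 2) (Fin 2) ℂ)).det ≠ 0 := by
    rw [det_smul]
    exact mul_ne_zero (pow_ne_zero _ hu) A.det_ne_zero
  have hδ0 : δ ≠ 0 := by
    rintro rfl
    exact hM0 (by rw [hδ, Complex.ofReal_zero])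
  let M : GL (Fin 2) ℂ := GeneralLinearGroup.mkOfDetNeZero _ hM0
  have hbM : BoundaryMap f (fun z => M • conjHat z) := by
    have : (fun z => M • conjHat z) = fun z => A • conjHat z :=
      funext fun z => smul_eq_smul_of_eq_smul hu rfl _
    rwa [this]
  have hneg : δ < 0 → IsCircleInversion f := fun h0 =>
    ⟨_, hbM, isInversionMap_of_isNormalized (M := M) h hδ h0⟩
  have hpos : 0 < δ → IsAntipodal f := fun h0 =>
    isAntipodal_of_isNormalized (M := M) hf hbM h hδ h0
  -- The converses hold because an inversion has a boundary fixed point, so no map is of both kinds.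
  refine ⟨hδ0.lt_or_gt.imp hneg hpos, δ, hδ, hδ0, ⟨hneg, fun h1 => ?_⟩, ⟨hpos, fun h1 => ?_⟩⟩
  · exact hδ0.lt_or_gt.resolve_right fun h2 => h1.not_isAntipodal (hpos h2)
  · exact hδ0.lt_or_gt.resolve_left fun h2 => (hneg h2).not_isAntipodal h1

end HypThree

end

theorem theoremA1 :
    (∀ (f : HypThree.Isom) (A : GL (Fin 2) ℂ), HypThree.InducedBy f A →
      (HypThree.OrientationPreserving f →
        ((¬ ∃ x : ℝ, HypThree.cInv A = x) →
          HypThree.RotatoryHyperbolic 1 f ∧ ¬ HypThree.IsStretchHalfTurn f) ∧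
        (∀ x : ℝ, HypThree.cInv A = x →
          (2 < |x - 2| → (0 < x → HypThree.IsStretch f) ∧
            (x < 0 → HypThree.IsStretchHalfTurn f)) ∧
          (x ≠ 0 → |x - 2| < 2 → HypThree.RotatoryElliptic 1 f ∧ ¬ HypThree.IsHalfTurn f) ∧
          (x = 0 → HypThree.IsHalfTurn f) ∧
          (x ≠ 0 → |x - 2| = 2 → ¬ HypThree.IsScalar A → HypThree.IsTranslation f) ∧
          (x ≠ 0 → |x - 2| = 2 → HypThree.IsScalar A → f = 1))) ∧
      (HypThree.OrientationReversing f →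
        ∃ x : ℝ, HypThree.cInv (HypThree.sqMatrix A) = x ∧ 0 ≤ x ∧
          (x = 0 ∨ |x - 2| < 2 → HypThree.RotatoryEllipticInversion 1 f) ∧
          (2 < |x - 2| → HypThree.RotatoryHyperbolicInversion 0 f) ∧
          (x ≠ 0 → |x - 2| = 2 → ¬ HypThree.IsScalar (HypThree.sqMatrix A) →
            HypThree.RotatoryParabolicInversion 0 f) ∧
          (x ≠ 0 → |x - 2| = 2 → HypThree.IsScalar (HypThree.sqMatrix A) →
            (HypThree.IsCircleInversion f ∨ HypThree.IsAntipodal f) ∧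
            (∃ k, HypThree.RotatoryEllipticInversion k f) ∧
            ∃ u : ℂ, u ≠ 0 ∧
              HypThree.IsNormalized (u • (A : Matrix (Fin 2) (Fin 2) ℂ)) ∧
              (∀ v : ℂ, (v ≠ 0 ∧ HypThree.IsNormalized (v • (A : Matrix (Fin 2) (Fin 2) ℂ))) ↔
                ∃ t : ℝ, t ≠ 0 ∧ v = t * u) ∧
              ∃ δ : ℝ, (u • (A : Matrix (Fin 2) (Fin 2) ℂ)).det = δ ∧ δ ≠ 0 ∧
                (δ < 0 ↔ HypThree.IsCircleInversion f) ∧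
                (0 < δ ↔ HypThree.IsAntipodal f)))) ∧
    (∀ f : HypThree.Isom,
      (HypThree.IsCircleInversion f → HypThree.RotatoryEllipticInversion 0 f) ∧
      (HypThree.IsAntipodal f → HypThree.RotatoryEllipticInversion 1 f)) := by
  refine ⟨fun f A hfA => ⟨fun hf => ?_, fun hf => ?_⟩, fun f =>
    ⟨HypThree.IsCircleInversion.rotatoryEllipticInversion_zero,
      HypThree.IsAntipodal.rotatoryEllipticInversion_one⟩⟩
  · have h := HypThree.actsBy_of_boundaryMap (hfA.boundaryMap_of_preserving hf)
    have hA := A.det_ne_zero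
    refine ⟨h.loxodromic hA, fun x hx => ⟨fun h2 => ⟨h.isStretch hA hx h2,
      h.isStretchHalfTurn hA hx h2⟩, fun _ => h.rotatoryElliptic hA hx, ?_, ?_, ?_⟩⟩
    · rintro rfl
      exact h.isHalfTurn hA hx
    · intro h0 h2
      obtain rfl := HypThree.eq_four_of_abs_sub_two h0 h2
      exact h.isTranslation hA hx
    · intro _ _ hs
      exact HypThree.eq_one_of_lin_eq_self (h.lin_eq_self_of_isScalar hA hs)
  · have hb := hfA.boundaryMap_of_reversing hf
    have h := HypThree.actsByConj_of_boundaryMap hb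
    have hA := A.det_ne_zero
    set τ := HypThree.sqTrace (A : Matrix (Fin 2) (Fin 2) ℂ) with hτ
    refine ⟨τ ^ 2, HypThree.cInv_mul_map_conj hA, sq_nonneg _, fun h2 => ?_, fun h2 => ?_,
      fun h0 h2 hs => ?_, fun _ _ hs => ?_⟩
    · refine h.rotatoryEllipticInversion_one hA (abs_lt_of_sq_lt_sq ?_ zero_le_two)
      rcases h2 with h2 | h2
      · rw [← hτ, h2]; norm_num
      · linarith [(abs_lt.1 h2).2]
    · refine h.rotatoryHyperbolicInversion_zero hA (lt_of_pow_lt_pow_left₀ 2 (abs_nonneg _) ?_)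
      rw [sq_abs, ← hτ]
      rcases lt_abs.1 h2 with h2 | h2
      · linarith
      · linarith [sq_nonneg τ]
    · have h4 := HypThree.eq_four_of_abs_sub_two h0 h2
      refine h.rotatoryParabolicInversion_zero hA ?_ hs
      -- `τ² = 4` leaves both signs; `τ = -2` contradicts that `A Ā` is not scalar.
      rcases sq_eq_sq_iff_eq_or_eq_neg.1 (h4.trans (by norm_num : (4 : ℝ) = 2 ^ 2)) with h5 | h5
      · exact h5
      · exact absurd (HypThree.isScalar_of_sqTrace hA h5) hs
    · obtain ⟨u, hu, hN, hiff⟩ := HypThree.exists_normalizing_scalar hA hs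
      obtain ⟨h3, h4⟩ := HypThree.isCircleInversion_or_isAntipodal hf hb hu hN
      exact ⟨h3, h3.elim (fun h5 => ⟨0, h5.rotatoryEllipticInversion_zero⟩)
        fun h5 => ⟨1, h5.rotatoryEllipticInversion_one⟩, u, hu, hN, hiff, h4⟩
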